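/- A digraph $D$ is a finite directed multigraph (finite vertex set $V(D)$, finite edge set $E(D)$, parallel edges allowed) without loops. A circuit is a closed trail (edges pairwise distinct, each directed from the preceding vertex to the next) up to cyclic permutation of its edges; a cycle is a circuit with at least one edge and without repeated vertices, and $\mathcal{B}(D)$ denotes the set of cycles of $D$. $D$ is Eulerian if some circuit traverses every edge. A partition of $D$ into cycles is a set of cycles whose edge sets are pairwise disjoint and have union $E(D)$. Let $\mathcal{S}$ be the smallest class of digraphs that contains all (finite, directed) cycles and contains the union of $D_1$ and $D_2$ whenever $D_1,D_2$ belong to it and have exactly one vertex in common. A (spanning) arborescence of $D$ rooted at $u$ is a set of edges of $D$ along which every vertex can be reached from $u$, with no edge entering $u$ and exactly one edge entering each other vertex. Let $T(D)$ be the set of partitions of $E(D)$ into nonempty parts each of which is the edge set of an Eulerian (in particular connected) subdigraph, ordered by refinement (finer partitions are smaller). Theorem. Let $D$ be a (weakly) connected Eulerian digraph with at least one edge. Then the following are equivalent: (1) no two distinct cycles of $D$ share an edge; (2) every edge of $D$ is contained in exactly one cycle; (3) $\mathcal{B}(D)$ is a partition of $D$ into cycles; (4) $D$ has a unique partition into cycles;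 (5) $D\in\mathcal{S}$; (6) $|\mathcal{B}(D)| = |E(D)|-|V(D)|+1$; (7) $D$ has a unique arborescence rooted at $u$ for some vertex $u$; (7') $D$ has a unique arborescence rooted at $u$ for every vertex $u$; (8) $T(D)$ is a lattice; (8') $T(D)$ is a lattice and has a unique minimal element. -/

import Mathlib

/-- A loopless directed multigraph with vertex type `V` and edge type `E`:
the edge `e` goes from `src e` to `tgt e`. Parallel edges are allowed. -/
structure MultiDigraph (V E : Type*) where
  src : E → V
  tgt : E → V
  loopless : ∀ e, src e ≠ tgt e

namespace MultiDigraph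

variable {V E : Type*} (D : MultiDigraph V E)

/-- `D` is (weakly) connected: its underlying undirected graph is connected.
In particular `V` is nonempty. -/
def IsConnected : Prop :=
  (SimpleGraph.fromRel fun u v : V => ∃ e, D.src e = u ∧ D.tgt e = v).Connected

/-- A circuit: a closed trail up to cyclic permutation of its edges. The type `Cycle E` of
Mathlib consists of the lists of edges up to rotation; the edges are pairwise distinct, and the
terminal vertex of each edge is the initial vertex of the (cyclically) next one. -/
def IsCircuit (c : Cycle E) : Prop :=
  c.Nodup ∧ c.Chain fun e f => D.tgt e = D.src f

/-- A cycle: a circuit with at least one edge, and without repeated vertices. -/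
def IsCycle (c : Cycle E) : Prop :=
  D.IsCircuit c ∧ c ≠ Cycle.nil ∧ (c.map D.src).Nodup

/-- The set of all cycles of `D`. -/
def cycles : Set (Cycle E) := {c | D.IsCycle c}

/-- The set of edges of a cyclic sequence of edges. -/
def edgesOf (c : Cycle E) : Set E := {e | e ∈ c}

/-- There are only finitely many cycles, so that counting them by `Set.ncard` is meaningful. -/
theorem cycles_finite [Finite E] : D.cycles.Finite := by
  classical
  have := Fintype.ofFinite E
  have h : Finite {c : Cycle E // c.Nodup} := inferInstance
  exact Set.Finite.subset (s := {c : Cycle E | c.Nodup}) h fun c hc => hc.1.1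

/-- The edge set `A` (with the vertices incident to it) forms an Eulerian subdigraph: some circuit
traverses exactly the edges in `A`. -/
def IsEulerianSet (A : Set E) : Prop :=
  ∃ c : Cycle E, D.IsCircuit c ∧ edgesOf c = A

/-- `D` is Eulerian: some circuit traverses every edge. -/
def IsEulerian : Prop := D.IsEulerianSet Set.univ

/-- `P` is a partition of `D` into cycles: a set of cycles of `D` whose edge sets are pairwise
disjoint and cover all edges. -/
def IsCyclePartition (P : Set (Cycle E)) : Prop :=
  P ⊆ D.cycles ∧ P.PairwiseDisjoint edgesOf ∧ ⋃ c ∈ P, edgesOf c = Set.univ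

/-- A subdigraph of `D`. -/
@[ext]
structure Sub where
  verts : Set V
  edges : Set E
  src_mem : ∀ e ∈ edges, D.src e ∈ verts
  tgt_mem : ∀ e ∈ edges, D.tgt e ∈ verts

variable {D}

/-- The union of two subdigraphs. -/
def Sub.union (H K : D.Sub) : D.Sub where
  verts := H.verts ∪ K.verts
  edges := H.edges ∪ K.edges
  src_mem := fun e he => he.imp (H.src_mem e) (K.src_mem e)
  tgt_mem := fun e he => he.imp (H.tgt_mem e) (K.tgt_mem e)

/-- The subdigraph `H` is (the digraph formed by the vertices and edges of) a cycle. -/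
def Sub.IsCycleDigraph (H : D.Sub) : Prop :=
  ∃ c ∈ D.cycles, H.edges = edgesOf c ∧ H.verts = D.src '' edgesOf c

/-- The class `S` of bridgeless cactus digraphs: the closure of the cycles under forming the union
of two digraphs that have exactly one vertex in common. (Whenever a digraph is obtained as such a
union, both constituents are subdigraphs of it, so nothing is lost by describing the class on the
subdigraphs of an arbitrary digraph.) -/
inductive Sub.InS : D.Sub → Prop
  | cycle (H : D.Sub) : H.IsCycleDigraph → H.InS
  | glue (H K : D.Sub) (v : V) : H.InS → K.InS → H.verts ∩ K.verts = {v} → (H.union K).InS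

variable (D)

/-- The digraph `D`, as a subdigraph of itself. -/
def whole : D.Sub where
  verts := Set.univ
  edges := Set.univ
  src_mem := fun _ _ => trivial
  tgt_mem := fun _ _ => trivial

/-- `D` belongs to the class `S`. -/
def MemS : Prop := D.whole.InS

/-- The edge set `T` forms a spanning arborescence rooted at `u`: no edge of `T` enters `u`, exactly
one edge of `T` enters any other vertex, and every vertex can be reached from `u` along a directed
path with edges in `T`. -/
def IsArborescence (u : V) (T : Set E) : Prop :=
  (∀ e ∈ T, D.tgt e ≠ u) ∧
  (∀ v, v ≠ u → ∃! e, e ∈ T ∧ D.tgt e = v) ∧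
  ∀ v, Relation.ReflTransGen (fun x y => ∃ e ∈ T, D.src e = x ∧ D.tgt e = y) u v

/-- The poset `T(D)`: partitions of the edge set (encoded by equivalence relations) all of whose
parts are Eulerian, ordered by refinement, with the finer partition being the smaller one. -/
def EulerianPartition : Type _ :=
  {r : Setoid E // ∀ A ∈ r.classes, D.IsEulerianSet A}

instance : PartialOrder D.EulerianPartition :=
  inferInstanceAs (PartialOrder {r : Setoid E // ∀ A ∈ r.classes, D.IsEulerianSet A})

/-- A partially ordered set is a lattice: any two elements have a join and a meet. -/
def IsLatticeOrder (P : Type*) [PartialOrder P] : Prop :=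
  ∀ x y : P, (∃ z, IsLUB {x, y} z) ∧ ∃ z, IsGLB {x, y} z

end MultiDigraph

/-! The argument takes place in the rational space of circulations, the kernel of `boundary`. A
circuit is a circulation, and a balanced edge set splits into disjoint cycles. In an Eulerian
digraph the all-ones weighting is a circulation, so the cycles span the space
(`circulations_eq_span`), whose dimension is at least |E| - |V| + 1.

If distinct cycles are edge-disjoint, every circulation is constant along each cycle, so a cycle
attached to a cactus cannot meet it in two vertices (`memS_of_pairwiseDisjoint`). In a cactus each
cycle lies in one constituent, which gives the cycle count by induction. With that count the
spanning cycles form a basis, so two partitions into cycles, both summing to the all-ones weighting,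
coincide. Every cycle extends to a partition, so uniqueness of the partition forces disjointness.

Arborescences of a glued union restrict to the constituents, so a cactus has at most one for each
root. Conversely, let T be the only one at some root. By exchange, each edge outside T closes up a
directed tree path. Hence only one edge enters the subtree below a tree edge, and by balance only
one leaves it; these two lie on the same cycles. The leaving edge is outside T, and such an edge
lies on its fundamental cycle only (`eq_of_mem_of_notMem`).

In T(D) joins always exist because touching circuits merge, and partitions into cycles are minimal.
A lattice has at most one minimal element. Conversely, if the set of all cycles is a partition, it
is the least element, and a finite join-semilattice with a least element is a lattice. -/

namespace MultiDigraph

variable {V E : Type*} {D : MultiDigraph V E}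

/-! ### Cycles as minimal successor-closed edge sets. -/

/-- Every edge of `B` is followed by an edge of `B`. -/
def SuccClosed (D : MultiDigraph V E) (B : Set E) : Prop :=
  ∀ e ∈ B, ∃ f ∈ B, D.tgt e = D.src f

theorem exists_coe_cons_of_mem {α : Type*} {c : Cycle α} {e : α} (h : e ∈ c) :
    ∃ l : List α, c = ((e :: l : List α) : Cycle α) := by
  induction c using Quotient.inductionOn' with
  | h l =>
    have h' : e ∈ l := h
    obtain ⟨s, t, rfl⟩ := List.append_of_mem h'
    exact ⟨t ++ s, Quotient.sound' ⟨s.length, by simp⟩⟩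

theorem IsCircuit.exists_succ {c : Cycle E} (hc : D.IsCircuit c) {e : E} (he : e ∈ c) :
    ∃ f ∈ c, D.tgt e = D.src f := by
  obtain ⟨l, rfl⟩ := exists_coe_cons_of_mem he
  have h := hc.2
  rw [Cycle.chain_coe_cons] at h
  cases l with
  | nil => exact ⟨e, by simp, by simpa using h⟩
  | cons a l => exact ⟨a, by simp, by simp at h; exact h.1⟩

theorem IsCircuit.succClosed {c : Cycle E} (hc : D.IsCircuit c) : D.SuccClosed (edgesOf c) :=
  fun _ he => hc.exists_succ he

theorem IsCircuit.exists_pred {c : Cycle E} (hc : D.IsCircuit c) {e : E} (he : e ∈ c) :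
    ∃ f ∈ c, D.tgt f = D.src e := by
  obtain ⟨l, rfl⟩ := exists_coe_cons_of_mem he
  have h := hc.2
  rw [Cycle.chain_coe_cons] at h
  rcases List.eq_nil_or_concat l with rfl | ⟨l, a, rfl⟩
  · exact ⟨e, by simp, by simpa using h⟩
  · refine ⟨a, by simp, ?_⟩
    simp only [List.concat_eq_append, List.append_assoc, List.cons_append, List.nil_append] at h
    rw [← List.cons_append, List.isChain_append_cons_cons] at h
    exact h.2.1

theorem IsCycle.nonempty {c : Cycle E} (hc : D.IsCycle c) : (edgesOf c).Nonempty := by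
  induction c using Quotient.inductionOn' with
  | h l =>
    cases l with
    | nil => exact absurd rfl hc.2.1
    | cons a l => exact ⟨a, List.mem_cons_self⟩

theorem IsCycle.src_injOn {c : Cycle E} (hc : D.IsCycle c) : Set.InjOn D.src (edgesOf c) := by
  intro a ha b hb hab
  induction c using Quotient.inductionOn' with
  | h l =>
    have : (l.map D.src).Nodup := hc.2.2
    exact List.inj_on_of_nodup_map this ha hb hab

theorem IsCycle.src_image_eq_tgt_image {c : Cycle E} (hc : D.IsCycle c) :
    D.src '' edgesOf c = D.tgt '' edgesOf c := by
  ext v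
  constructor
  · rintro ⟨e, he, rfl⟩
    obtain ⟨f, hf, h⟩ := hc.1.exists_pred he
    exact ⟨f, hf, h⟩
  · rintro ⟨e, he, rfl⟩
    obtain ⟨f, hf, h⟩ := hc.1.exists_succ he
    exact ⟨f, hf, h.symm⟩

/-- Injectivity of `src` on `A` leaves each edge at most one successor in `A`, so a walk in `A` that
starts in `B` is forced to stay in `B`. -/
theorem mem_of_isChain_of_succClosed {A B : Set E} (hA : Set.InjOn D.src A) (hBA : B ⊆ A)
    (hB : D.SuccClosed B) (l : List E) :
    ∀ e ∈ B, List.IsChain (fun e f => D.tgt e = D.src f) (e :: l) → (∀ f ∈ l, f ∈ A) →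
      ∀ f ∈ l, f ∈ B := by
  induction l with
  | nil => simp
  | cons a l ih =>
    intro e he hch hl
    rw [List.isChain_cons_cons] at hch
    obtain ⟨f, hf, hef⟩ := hB e he
    have haf : a = f := hA (hl a (by simp)) (hBA hf) (hch.1.symm.trans hef)
    have ha : a ∈ B := haf ▸ hf
    intro g hg
    rcases List.mem_cons.1 hg with rfl | hg
    · exact ha
    · exact ih a ha hch.2 (fun f hf => hl f (by simp [hf])) g hg

/-- Following successors from one edge of `B` goes all the way round the cycle. This minimality is
the main tool for showing that an edge set fills a cycle. -/
theorem IsCycle.eq_of_succClosed {c : Cycle E} (hc : D.IsCycle c) {B : Set E}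
    (hne : B.Nonempty) (hBc : B ⊆ edgesOf c) (hB : D.SuccClosed B) : B = edgesOf c := by
  refine hBc.antisymm ?_
  obtain ⟨e, he⟩ := hne
  have hinj := hc.src_injOn
  obtain ⟨l, rfl⟩ := exists_coe_cons_of_mem (hBc he)
  have h := hc.1.2
  rw [Cycle.chain_coe_cons, ← List.cons_append] at h
  have := mem_of_isChain_of_succClosed hinj hBc hB l e he (List.isChain_append.1 h).1
    (fun f hf => by simp [edgesOf, hf])
  intro f hf
  rcases (by simpa [edgesOf] using hf : f = e ∨ f ∈ l) with rfl | hf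
  · exact he
  · exact this f hf

theorem eq_of_isChain_of_injOn {A : Set E} (hA : Set.InjOn D.src A) (l : List E) :
    ∀ (l' : List E) (e : E), l.length = l'.length →
      List.IsChain (fun e f => D.tgt e = D.src f) (e :: l) →
      List.IsChain (fun e f => D.tgt e = D.src f) (e :: l') → (∀ f ∈ l, f ∈ A) →
      (∀ f ∈ l', f ∈ A) → l = l' := by
  induction l with
  | nil => intro l' e h _ _ _ _; simpa [eq_comm] using h
  | cons a l ih =>
    intro l' e h h1 h2 h3 h4
    cases l' with
    | nil => simp at h
    | cons b l' =>
      rw [List.isChain_cons_cons] at h1 h2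
      have hab : a = b := hA (h3 a (by simp)) (h4 b (by simp)) (h1.1.symm.trans h2.1)
      subst hab
      rw [ih l' a (by simpa using h) h1.2 h2.2 (fun f hf => h3 f (by simp [hf]))
        (fun f hf => h4 f (by simp [hf]))]

/-- By minimality the edge sets agree. Rotated to a common first edge, both lists are then the same
forced walk, of the same length. -/
theorem IsCycle.eq_of_subset {c c' : Cycle E} (hc : D.IsCycle c) (hc' : D.IsCycle c')
    (h : edgesOf c ⊆ edgesOf c') : c = c' := by
  have heq := hc'.eq_of_succClosed hc.nonempty h hc.1.succClosed
  obtain ⟨e, he⟩ := hc.nonempty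
  have hinj := hc.src_injOn
  have he' : e ∈ edgesOf c' := h he
  obtain ⟨l, rfl⟩ := exists_coe_cons_of_mem he
  obtain ⟨l', rfl⟩ := exists_coe_cons_of_mem he'
  have h1 := hc.1.2
  have h2 := hc'.1.2
  rw [Cycle.chain_coe_cons, ← List.cons_append] at h1 h2
  have n1 : (e :: l).Nodup := hc.1.1
  have n2 : (e :: l').Nodup := hc'.1.1
  have hp : (e :: l).Perm (e :: l') :=
    (List.perm_ext_iff_of_nodup n1 n2).2 fun f => (Set.ext_iff.1 heq f)
  rw [eq_of_isChain_of_injOn hinj l l' e (by simpa using hp.length_eq)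
    (List.isChain_append.1 h1).1 (List.isChain_append.1 h2).1
    (fun f hf => by simp [edgesOf, hf])
    (fun f hf => heq ▸ (by simp [edgesOf, hf]))]

theorem IsCycle.eq_of_edgesOf_eq {c c' : Cycle E} (hc : D.IsCycle c) (hc' : D.IsCycle c')
    (h : edgesOf c = edgesOf c') : c = c' :=
  hc.eq_of_subset hc' h.subset

theorem exists_isCycle_of_succClosed [Finite E] {B : Set E} (hne : B.Nonempty)
    (hB : D.SuccClosed B) : ∃ c, D.IsCycle c ∧ edgesOf c ⊆ B := by
  classical
  obtain ⟨e₀, he₀⟩ := hne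
  -- The successor is chosen per vertex, not per edge, so that an orbit of `s` cannot leave one
  -- vertex by two different edges.
  have hg : ∃ g : V → E, ∀ e ∈ B, g (D.tgt e) ∈ B ∧ D.src (g (D.tgt e)) = D.tgt e := by
    refine ⟨fun v => if h : ∃ f ∈ B, D.src f = v then h.choose else e₀, fun e he => ?_⟩
    obtain ⟨f, hf, hef⟩ := hB e he
    have h : ∃ f ∈ B, D.src f = D.tgt e := ⟨f, hf, hef.symm⟩
    simp only [dif_pos h]
    exact h.choose_spec
  obtain ⟨g, hg⟩ := hg
  set s : E → E := fun e => g (D.tgt e) with hs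
  have hsB : ∀ n, s^[n] e₀ ∈ B := by
    intro n
    induction n with
    | zero => exact he₀
    | succ n ih => rw [Function.iterate_succ_apply']; exact (hg _ ih).1
  obtain ⟨e, heB, hep⟩ : ∃ e, (∀ n, s^[n] e ∈ B) ∧ e ∈ Function.periodicPts s := by
    obtain ⟨i, j, hij, h⟩ := Finite.exists_ne_map_eq_of_infinite fun n => s^[n] e₀
    wlog hlt : i < j generalizing i j
    · exact this j i hij.symm h.symm (by omega)
    refine ⟨s^[i] e₀, fun n => by rw [← Function.iterate_add_apply]; exact hsB _,
      Function.mk_mem_periodicPts (n := j - i) (by omega) ?_⟩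
    rw [Function.IsPeriodicPt, Function.IsFixedPt, ← Function.iterate_add_apply]
    have : j - i + i = j := by omega
    rw [this]; exact h.symm
  have hmem : ∀ f ∈ Function.periodicOrbit s e, f ∈ B := by
    intro f hf
    obtain ⟨n, rfl⟩ := (Function.mem_periodicOrbit_iff hep).1 hf
    exact heB n
  -- An orbit edge is determined by its source, so distinct orbit edges have distinct sources.
  have hmem' : ∀ f ∈ Function.periodicOrbit s e, f = g (D.src f) := by
    intro f hf
    obtain ⟨n, rfl⟩ := (Function.mem_periodicOrbit_iff hep).1 hf
    have hpos := Function.minimalPeriod_pos_of_mem_periodicPts hep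
    -- Going round one full period supplies a predecessor even when `n = 0`.
    obtain ⟨m, hm⟩ : ∃ m, s^[n] e = s^[m + 1] e := by
      refine ⟨n + Function.minimalPeriod s e - 1, ?_⟩
      have : n + Function.minimalPeriod s e - 1 + 1 = n + Function.minimalPeriod s e := by omega
      rw [this, Function.iterate_add_minimalPeriod_eq]
    rw [hm, Function.iterate_succ_apply']
    conv_lhs => rw [hs]
    exact congrArg g (hg _ (heB m)).2.symm
  refine ⟨Function.periodicOrbit s e, ⟨⟨Function.nodup_periodicOrbit, ?_⟩, ?_, ?_⟩, hmem⟩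
  · rw [Function.periodicOrbit_chain' _ hep]
    intro n
    rw [Function.iterate_succ_apply']
    exact (hg _ (heB n)).2.symm
  · rw [Ne, Function.periodicOrbit_eq_nil_iff_not_periodic_pt]
    exact not_not.2 hep
  · have hn : (Function.periodicOrbit s e).Nodup := Function.nodup_periodicOrbit
    generalize Function.periodicOrbit s e = c at hn hmem'
    induction c using Quotient.inductionOn' with
    | h l =>
      refine List.Nodup.map_on ?_ hn
      intro a ha b hb hab
      rw [hmem' a ha, hmem' b hb, hab]

theorem IsEulerianSet.union_of_disjoint {A B : Set E} (hA : D.IsEulerianSet A)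
    (hB : D.IsEulerianSet B) (hd : Disjoint A B) {e f : E} (he : e ∈ A) (hf : f ∈ B)
    (h : D.tgt e = D.src f) : D.IsEulerianSet (A ∪ B) := by
  obtain ⟨c, hc, rfl⟩ := hA
  obtain ⟨c', hc', rfl⟩ := hB
  obtain ⟨l, rfl⟩ := exists_coe_cons_of_mem he
  obtain ⟨m, rfl⟩ := exists_coe_cons_of_mem hf
  have h1 := hc.2
  have h2 := hc'.2
  rw [Cycle.chain_coe_cons] at h1 h2
  have n1 : (e :: l).Nodup := hc.1
  have n2 : (f :: m).Nodup := hc'.1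
  -- The second circuit is inserted right after `e`: it starts and ends at the target of `e`, so the
  -- tour can then resume along `l`.
  refine ⟨((e :: f :: (m ++ l) : List E) : Cycle E), ⟨?_, ?_⟩, ?_⟩
  · have : ((e :: l) ++ (f :: m)).Nodup := List.nodup_append'.2 ⟨n1, n2, fun x hx hx' =>
      (Set.disjoint_left.1 hd) hx hx'⟩
    have hp : ((e :: l) ++ (f :: m)).Perm (e :: f :: (m ++ l)) := by
      simp only [List.cons_append]
      exact (List.perm_append_comm.trans (by simp)).cons e
    exact hp.nodup this
  · rw [Cycle.chain_coe_cons]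
    simp only [List.cons_append, List.append_assoc, List.isChain_cons_cons]
    refine ⟨h, ?_⟩
    rw [← List.cons_append] at h2 ⊢
    obtain ⟨h3, -, h4⟩ := List.isChain_append.1 h2
    rw [List.isChain_cons] at h1
    refine List.isChain_append.2 ⟨h3, h1.2, fun x hx y hy => ?_⟩
    rw [h4 x hx f (by simp), ← h, h1.1 y hy]
  · ext x
    simp only [edgesOf, Set.mem_ofPred_eq, Cycle.mem_coe_iff, List.mem_cons, List.mem_append,
      Set.mem_union]
    tauto

/-! ### The space of circulations and its spanning by cycles. -/

/-- The indicator function of an edge set. -/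
noncomputable def ind (A : Set E) : E → ℚ := A.indicator 1

theorem ind_of_mem {A : Set E} {e : E} (h : e ∈ A) : ind A e = 1 := Set.indicator_of_mem h _

theorem ind_of_notMem {A : Set E} {e : E} (h : e ∉ A) : ind A e = 0 := Set.indicator_of_notMem h _

theorem ind_diff {A B : Set E} (h : B ⊆ A) : ind (A \ B) = ind A - ind B := by
  ext e
  by_cases hB : e ∈ B
  · simp [ind_of_mem hB, ind_of_mem (h hB), ind_of_notMem (fun h' : e ∈ A \ B => h'.2 hB)]
  · by_cases hA : e ∈ A
    · simp [ind_of_notMem hB, ind_of_mem hA, ind_of_mem (show e ∈ A \ B from ⟨hA, hB⟩)]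
    · simp [ind_of_notMem hB, ind_of_notMem hA, ind_of_notMem (fun h' : e ∈ A \ B => hA h'.1)]

section Circulation

variable [Fintype E]

open Classical in
/-- The net inflow of the edge weighting `f` at each vertex. -/
noncomputable def boundary (D : MultiDigraph V E) : (E → ℚ) →ₗ[ℚ] (V → ℚ) where
  toFun f := ∑ e, f e • (Pi.single (D.tgt e) (1 : ℚ) - Pi.single (D.src e) 1)
  map_add' f g := by simp only [Pi.add_apply, add_smul, Finset.sum_add_distrib]
  map_smul' a f := by simp only [Pi.smul_apply, smul_assoc, Finset.smul_sum, RingHom.id_apply]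

/-- The weightings of the edges with zero net inflow at each vertex. -/
noncomputable def circulations (D : MultiDigraph V E) : Submodule ℚ (E → ℚ) :=
  LinearMap.ker D.boundary

open Classical in
theorem boundary_apply (f : E → ℚ) :
    D.boundary f = ∑ e, f e • (Pi.single (D.tgt e) (1 : ℚ) - Pi.single (D.src e) 1) := rfl

open Classical in
theorem boundary_apply_apply (f : E → ℚ) (v : V) :
    D.boundary f v = ∑ e, f e * ((if D.tgt e = v then 1 else 0) - if D.src e = v then 1 else 0) := by
  rw [boundary_apply, Finset.sum_apply]
  refine Finset.sum_congr rfl fun e _ => ?_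
  simp [Pi.single_apply, eq_comm]

open Classical in
theorem boundary_single (e : E) :
    D.boundary (Pi.single e 1) = Pi.single (D.tgt e) (1 : ℚ) - Pi.single (D.src e) 1 := by
  rw [boundary_apply, Finset.sum_eq_single e]
  · simp
  · intro b _ hb; simp [hb]
  · simp

open Classical in
theorem sum_boundary [Fintype V] (f : E → ℚ) (S : Set V) :
    ∑ v ∈ S.toFinset, D.boundary f v =
      ∑ e, f e * ((if D.tgt e ∈ S then 1 else 0) - if D.src e ∈ S then 1 else 0) := by
  simp_rw [boundary_apply_apply]
  rw [Finset.sum_comm]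
  refine Finset.sum_congr rfl fun e _ => ?_
  rw [← Finset.mul_sum, Finset.sum_sub_distrib]
  simp

open Classical in
theorem cut_eq_zero [Fintype V] {f : E → ℚ} (hf : f ∈ D.circulations) (S : Set V) :
    ∑ e, f e * ((if D.tgt e ∈ S then 1 else 0) - if D.src e ∈ S then 1 else 0) = 0 := by
  rw [← sum_boundary]
  have : D.boundary f = 0 := hf
  simp [this]

theorem ind_mem_circulations_of_isCircuit {c : Cycle E} (hc : D.IsCircuit c) :
    ind (edgesOf c) ∈ D.circulations := by
  classical
  induction c using Quotient.inductionOn' with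
  | h l =>
  cases l with
  | nil =>
    have : ind (edgesOf (Quotient.mk'' [] : Cycle E)) = 0 := by
      ext e
      exact ind_of_notMem (Cycle.notMem_nil e)
    rw [this]
    exact Submodule.zero_mem _
  | cons a l =>
  have hn : (a :: l).Nodup := hc.1
  have hch : Cycle.Chain (fun e f => D.tgt e = D.src f) ((a :: l : List E) : Cycle E) := hc.2
  rw [Cycle.chain_coe_cons] at hch
  -- The boundaries telescope along a trail; closing it up with `b = a` gives zero.
  have key : ∀ (l : List E) (a b : E),
      List.IsChain (fun e f => D.tgt e = D.src f) (a :: (l ++ [b])) →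
      ((a :: l).map fun e => (Pi.single (D.tgt e) (1 : ℚ) - Pi.single (D.src e) 1 : V → ℚ)).sum =
        Pi.single (D.src b) 1 - Pi.single (D.src a) 1 := by
    intro l
    induction l with
    | nil => intro a b h; simp at h; simp [h]
    | cons x l ih =>
      intro a b h
      rw [List.cons_append, List.isChain_cons_cons] at h
      rw [List.map_cons, List.sum_cons, ih x b h.2, h.1]
      abel
  have h0 := key l a a hch
  rw [sub_self] at h0
  change D.boundary _ = 0
  rw [boundary_apply, ← h0, ← List.sum_toFinset _ hn]
  rw [← Finset.sum_subset (Finset.subset_univ (a :: l).toFinset)]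
  · refine Finset.sum_congr rfl fun e he => ?_
    rw [ind_of_mem, one_smul]
    exact List.mem_toFinset.1 he
  · intro e _ he
    rw [ind_of_notMem, zero_smul]
    exact fun h => he (List.mem_toFinset.2 h)

theorem IsEulerianSet.ind_mem_circulations {A : Set E} (hA : D.IsEulerianSet A) :
    ind A ∈ D.circulations := by
  obtain ⟨c, hc, rfl⟩ := hA
  exact ind_mem_circulations_of_isCircuit hc

/-- Otherwise no weight leaves the head of `e`, and the net inflow there is a sum of nonnegative
terms; the term of `e` is `f e`, as `e` is not a loop. -/
theorem exists_succ_of_mem_circulations {f : E → ℚ} (hf : f ∈ D.circulations) (h0 : ∀ e, 0 ≤ f e)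
    {e : E} (he : f e ≠ 0) : ∃ e', f e' ≠ 0 ∧ D.tgt e = D.src e' := by
  classical
  by_contra! hcon
  have h : D.boundary f (D.tgt e) = 0 := by
    have : D.boundary f = 0 := hf
    rw [this]; rfl
  rw [boundary_apply_apply] at h
  have hnn : ∀ i ∈ Finset.univ, 0 ≤ f i * ((if D.tgt i = D.tgt e then 1 else 0) -
      if D.src i = D.tgt e then 1 else 0) := by
    intro i _
    by_cases hi : D.src i = D.tgt e
    · have : f i = 0 := by_contra fun h => hcon i h hi.symm
      simp [this]
    · rw [if_neg hi, sub_zero]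
      exact mul_nonneg (h0 i) (by split_ifs <;> norm_num)
  have := (Finset.sum_eq_zero_iff_of_nonneg hnn).1 h e (Finset.mem_univ _)
  simp [D.loopless e, he] at this

theorem succClosed_of_ind_mem_circulations {A : Set E} (hA : ind A ∈ D.circulations) :
    D.SuccClosed A := by
  intro e he
  obtain ⟨f, hf, h⟩ := exists_succ_of_mem_circulations hA
    (fun e => Set.indicator_nonneg (fun _ _ => zero_le_one) e) (e := e) (by simp [ind_of_mem he])
  exact ⟨f, by_contra fun h' => hf (ind_of_notMem h'), h⟩

/-- A balanced edge set is the disjoint union of cycles. -/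
theorem exists_cycles_of_ind_mem_circulations {A : Set E} (hA : ind A ∈ D.circulations) :
    ∃ P : Set (Cycle E), P ⊆ D.cycles ∧ P.PairwiseDisjoint edgesOf ∧ ⋃ c ∈ P, edgesOf c = A := by
  induction hn : A.ncard using Nat.strong_induction_on generalizing A with
  | _ n ih =>
  rcases A.eq_empty_or_nonempty with rfl | hne
  · exact ⟨∅, by simp, by simp, by simp⟩
  obtain ⟨c, hc, hcA⟩ := exists_isCycle_of_succClosed hne (succClosed_of_ind_mem_circulations hA)
  have hlt : (A \ edgesOf c).ncard < n := by
    rw [← hn]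
    refine Set.ncard_lt_ncard ?_
    obtain ⟨e, he⟩ := hc.nonempty
    exact ⟨Set.sdiff_subset, fun h => (h (hcA he)).2 he⟩
  have hAc : ind (A \ edgesOf c) ∈ D.circulations := by
    rw [ind_diff hcA]
    exact Submodule.sub_mem _ hA (ind_mem_circulations_of_isCircuit hc.1)
  obtain ⟨P, hP, hd, hU⟩ := ih _ hlt hAc rfl
  refine ⟨insert c P, Set.insert_subset hc hP, ?_, ?_⟩
  · refine hd.insert fun c' hc' _ => ?_
    refine Set.disjoint_left.2 fun e he he' => ?_
    have : e ∈ A \ edgesOf c := hU ▸ Set.mem_biUnion hc' he'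
    exact this.2 he
  · rw [Set.biUnion_insert, hU, Set.union_sdiff_cancel hcA]

theorem exists_isCycle_mem_of_ind_mem_circulations {A : Set E} (hA : ind A ∈ D.circulations)
    {e : E} (he : e ∈ A) : ∃ c, D.IsCycle c ∧ e ∈ edgesOf c ∧ edgesOf c ⊆ A := by
  obtain ⟨P, hP, -, hU⟩ := exists_cycles_of_ind_mem_circulations hA
  rw [← hU] at he
  obtain ⟨c, hc, hec⟩ := Set.mem_iUnion₂.1 he
  exact ⟨c, hP hc, hec, hU ▸ Set.subset_biUnion_of_mem hc⟩

/-- The complement of a cycle is still balanced and hence decomposes. -/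
theorem exists_isCyclePartition_mem (h : ind (Set.univ : Set E) ∈ D.circulations) {c : Cycle E}
    (hc : D.IsCycle c) : ∃ P, D.IsCyclePartition P ∧ c ∈ P := by
  have hAc : ind (Set.univ \ edgesOf c) ∈ D.circulations := by
    rw [ind_diff (Set.subset_univ _)]
    exact Submodule.sub_mem _ h (ind_mem_circulations_of_isCircuit hc.1)
  obtain ⟨P, hP, hd, hU⟩ := exists_cycles_of_ind_mem_circulations hAc
  refine ⟨insert c P, ⟨Set.insert_subset hc hP, ?_, ?_⟩, Set.mem_insert _ _⟩
  · refine hd.insert fun c' hc' _ => ?_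
    refine Set.disjoint_left.2 fun e he he' => ?_
    have : e ∈ Set.univ \ edgesOf c := hU ▸ Set.mem_biUnion hc' he'
    exact this.2 he
  · rw [Set.biUnion_insert, hU, Set.union_sdiff_cancel (Set.subset_univ _)]

open Classical in
-- Subtracting from `f` its least value on a cycle in the support keeps it nonnegative and strictly
-- shrinks the support.
theorem mem_span_of_nonneg {f : E → ℚ} (hf : f ∈ D.circulations) (h0 : ∀ e, 0 ≤ f e) :
    f ∈ Submodule.span ℚ ((fun c => ind (edgesOf c)) '' D.cycles) := by
  induction hn : {e | f e ≠ 0}.ncard using Nat.strong_induction_on generalizing f with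
  | _ n ih =>
  by_cases hz : f = 0
  · rw [hz]; exact Submodule.zero_mem _
  have hne : {e | f e ≠ 0}.Nonempty := by
    by_contra h
    exact hz (funext fun e => by_contra fun he => h ⟨e, he⟩)
  obtain ⟨c, hc, hcA⟩ := exists_isCycle_of_succClosed (D := D) hne fun e he =>
    exists_succ_of_mem_circulations hf h0 he
  obtain ⟨e₀, he₀, hmin⟩ := Set.exists_min_image (edgesOf c) f (Set.toFinite _) hc.nonempty
  have hcm : ind (edgesOf c) ∈ Submodule.span ℚ ((fun c => ind (edgesOf c)) '' D.cycles) :=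
    Submodule.subset_span ⟨c, hc, rfl⟩
  have hval : ∀ e, (f - f e₀ • ind (edgesOf c)) e = if e ∈ edgesOf c then f e - f e₀ else f e := by
    intro e
    split_ifs with h
    · simp [ind_of_mem h]
    · simp [ind_of_notMem h]
  have hmem := ih ({e | (f - f e₀ • ind (edgesOf c)) e ≠ 0}.ncard) ?_
    (f := f - f e₀ • ind (edgesOf c))
    (Submodule.sub_mem _ hf (Submodule.smul_mem _ _ (ind_mem_circulations_of_isCircuit hc.1)))
    ?_ rfl
  · have := Submodule.add_mem _ hmem (Submodule.smul_mem _ (f e₀) hcm)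
    simpa using this
  · rw [← hn]
    refine Set.ncard_lt_ncard ⟨fun e he => ?_, fun h => ?_⟩
    · by_cases hec : e ∈ edgesOf c
      · exact hcA hec
      · have he' : (f - f e₀ • ind (edgesOf c)) e ≠ 0 := he
        rw [hval, if_neg hec] at he'
        exact he'
    · have he' : (f - f e₀ • ind (edgesOf c)) e₀ ≠ 0 := h (hcA he₀)
      rw [hval, if_pos he₀, sub_self] at he'
      exact he' rfl
  · intro e
    rw [hval]
    split_ifs with h
    · exact sub_nonneg.2 (hmin e h)
    · exact h0 e

/-- In an Eulerian digraph the cycles span the space of circulations. -/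
theorem circulations_eq_span (h : ind (Set.univ : Set E) ∈ D.circulations) :
    D.circulations = Submodule.span ℚ ((fun c => ind (edgesOf c)) '' D.cycles) := by
  refine le_antisymm (fun f hf => ?_) (Submodule.span_le.2 ?_)
  · have h1 := mem_span_of_nonneg h fun e => by simp [ind_of_mem]
    -- A large multiple of the all-ones circulation makes `f` nonnegative; the sum of the absolute
    -- values is a convenient bound.
    have h2 := mem_span_of_nonneg (f := f + (∑ e, |f e|) • ind Set.univ)
      (Submodule.add_mem _ hf (Submodule.smul_mem _ _ h)) fun e => by
        have h3 := Finset.single_le_sum (fun e _ => abs_nonneg (f e)) (Finset.mem_univ e)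
        have h4 := neg_abs_le (f e)
        simp only [Pi.add_apply, Pi.smul_apply, ind_of_mem (Set.mem_univ e), smul_eq_mul, mul_one]
        linarith
    simpa using Submodule.sub_mem _ h2 (Submodule.smul_mem _ (∑ e, |f e|) h1)
  · rintro _ ⟨c, hc, rfl⟩
    exact ind_mem_circulations_of_isCircuit hc.1

/-- If distinct cycles are edge-disjoint, a circulation is constant on each cycle. -/
theorem eq_of_mem_circulations (h : ind (Set.univ : Set E) ∈ D.circulations)
    (hd : D.cycles.PairwiseDisjoint edgesOf) {f : E → ℚ} (hf : f ∈ D.circulations) {c : Cycle E}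
    (hc : D.IsCycle c) {e e' : E} (he : e ∈ edgesOf c) (he' : e' ∈ edgesOf c) : f e = f e' := by
  rw [circulations_eq_span h] at hf
  induction hf using Submodule.span_induction with
  | mem f hf =>
    obtain ⟨c', hc', rfl⟩ := hf
    by_cases hcc : c = c'
    · subst hcc
      simp only [ind_of_mem he, ind_of_mem he']
    · have := Set.disjoint_left.1 (hd hc hc' hcc)
      simp only [ind_of_notMem (this he), ind_of_notMem (this he')]
  | zero => rfl
  | add f g _ _ h1 h2 => simp [h1, h2]
  | smul a f _ h1 => simp [h1]

/-- Boundaries have total sum zero, so the rank of `boundary` is at most |V| - 1. Only this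
inequality is needed, hence no connectedness. -/
theorem card_le_finrank_circulations [Fintype V] [Nonempty V] :
    (Fintype.card E : ℤ) - Fintype.card V + 1 ≤ Module.finrank ℚ D.circulations := by
  classical
  have h1 := LinearMap.finrank_range_add_finrank_ker D.boundary
  let σ : (V → ℚ) →ₗ[ℚ] ℚ := ∑ v, LinearMap.proj v
  have hσ : ∀ x, σ x = ∑ v, x v := fun x => by simp [σ]
  have h2 := LinearMap.finrank_range_add_finrank_ker σ
  have h3 : LinearMap.range σ = ⊤ := by
    rw [LinearMap.range_eq_top]
    intro q
    obtain ⟨v⟩ := ‹Nonempty V›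
    exact ⟨Pi.single v q, by rw [hσ]; simp⟩
  have h4 : LinearMap.range D.boundary ≤ LinearMap.ker σ := by
    rintro _ ⟨f, rfl⟩
    rw [LinearMap.mem_ker, hσ]
    have := sum_boundary (D := D) f Set.univ
    simpa using this
  have h5 := Submodule.finrank_mono h4
  rw [h3, finrank_top, Module.finrank_self, Module.finrank_fintype_fun_eq_card] at h2
  rw [Module.finrank_fintype_fun_eq_card] at h1
  change _ ≤ ((Module.finrank ℚ (LinearMap.ker D.boundary) : ℕ) : ℤ)
  omega

end Circulation

/-! ### The poset of Eulerian partitions. -/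

theorem exists_crossing_of_isChain {R : E → E → Prop} {C : Set E} (l : List E) :
    ∀ e ∈ C, List.IsChain R (e :: l) → (∃ f ∈ l, f ∉ C) →
      ∃ e' ∈ e :: l, ∃ f' ∈ l, e' ∈ C ∧ f' ∉ C ∧ R e' f' := by
  induction l with
  | nil => simp
  | cons a l ih =>
    intro e he hch ⟨f, hf, hfC⟩
    rw [List.isChain_cons_cons] at hch
    by_cases ha : a ∈ C
    · have hfl : f ∈ l := by
        rcases List.mem_cons.1 hf with rfl | h
        · exact absurd ha hfC
        · exact h
      obtain ⟨e', he', f', hf', h⟩ := ih a ha hch.2 ⟨f, hfl, hfC⟩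
      exact ⟨e', List.mem_cons_of_mem _ he', f', List.mem_cons_of_mem _ hf', h⟩
    · exact ⟨e, by simp, a, by simp, he, ha, hch.1⟩

theorem IsCircuit.exists_crossing {c : Cycle E} (hc : D.IsCircuit c) {C : Set E} {e f : E}
    (he : e ∈ c) (heC : e ∈ C) (hf : f ∈ c) (hfC : f ∉ C) :
    ∃ e' ∈ c, ∃ f' ∈ c, e' ∈ C ∧ f' ∉ C ∧ D.tgt e' = D.src f' := by
  obtain ⟨l, rfl⟩ := exists_coe_cons_of_mem he
  have h := hc.2
  rw [Cycle.chain_coe_cons, ← List.cons_append] at h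
  have hfl : f ∈ l := by
    rcases (by simpa using hf : f = e ∨ f ∈ l) with rfl | h
    · exact absurd heC hfC
    · exact h
  obtain ⟨e', he', f', hf', h⟩ :=
    exists_crossing_of_isChain l e heC (List.isChain_append.1 h).1 ⟨f, hfl, hfC⟩
  exact ⟨e', he', f', List.mem_cons_of_mem _ hf', h⟩

/-- A maximal Eulerian union of `r`-classes around `y` is also `s`-closed: an `s`-circuit leaving it
would do so at a common vertex, where a further `r`-class could be spliced in. -/
theorem EulerianPartition.isEulerianSet_of_mem_classes_sup [Finite E] (r s : D.EulerianPartition)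
    {A : Set E} (hA : A ∈ (r.1 ⊔ s.1).classes) : D.IsEulerianSet A := by
  obtain ⟨y, rfl⟩ := hA
  have hr : r.1 ≤ r.1 ⊔ s.1 := le_sup_left
  have hs : s.1 ≤ r.1 ⊔ s.1 := le_sup_right
  let F : Set (Set E) := {C | y ∈ C ∧ C ⊆ {x | (r.1 ⊔ s.1) x y} ∧ D.IsEulerianSet C ∧
    ∀ a ∈ C, ∀ b, r.1 a b → b ∈ C}
  have hF : F.Nonempty := by
    refine ⟨{x | r.1 x y}, r.1.refl y, fun x hx => hr hx, r.2 _ ⟨y, rfl⟩, fun a ha b hab => ?_⟩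
    exact r.1.trans (r.1.symm hab) ha
  obtain ⟨C, ⟨hyC, hCA, hC, hsat⟩, hmax⟩ := (Set.toFinite F).exists_maximal hF
  have hclosed : ∀ e ∈ C, ∀ f, s.1 e f → f ∈ C := by
    intro e he f hef
    by_contra hf
    obtain ⟨c, hc, hcs⟩ := s.2 {x | s.1 x e} ⟨e, rfl⟩
    have hec : e ∈ c := by
      change e ∈ edgesOf c
      rw [hcs]; exact s.1.refl e
    have hfc : f ∈ c := by
      change f ∈ edgesOf c
      rw [hcs]; exact s.1.symm hef
    obtain ⟨e', he', f', hf', he'C, hf'C, h⟩ := hc.exists_crossing hec he hfc hf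
    have h1 : s.1 e' e := by
      have : e' ∈ edgesOf c := he'
      rw [hcs] at this; exact this
    have h2 : s.1 f' e := by
      have : f' ∈ edgesOf c := hf'
      rw [hcs] at this; exact this
    have hd : Disjoint C {x | r.1 x f'} :=
      Set.disjoint_left.2 fun x hx hx' => hf'C (hsat x hx f' hx')
    have hE := hC.union_of_disjoint (r.2 {x | r.1 x f'} ⟨f', rfl⟩) hd he'C (r.1.refl f') h
    have hmem : C ∪ {x | r.1 x f'} ∈ F := by
      refine ⟨Or.inl hyC, Set.union_subset hCA fun x hx => ?_, hE, ?_⟩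
      · exact (r.1 ⊔ s.1).trans (hr hx) ((r.1 ⊔ s.1).trans
          (hs (s.1.trans h2 (s.1.symm h1))) (hCA he'C))
      · rintro a (ha | ha) b hab
        · exact Or.inl (hsat a ha b hab)
        · exact Or.inr (r.1.trans (r.1.symm hab) ha)
    exact hf'C (hmax hmem Set.subset_union_left (Or.inr (r.1.refl f')))
  -- The relation with blocks `C` and its complement is coarser than `r` and `s`, hence than their
  -- join, so the class of `y` stays inside `C`.
  let K : Setoid E := Setoid.comap (· ∈ C) ⊥
  have hK : r.1 ⊔ s.1 ≤ K := sup_le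
    (fun {x z} h => propext ⟨fun hx => hsat x hx z h, fun hz => hsat z hz x (r.1.symm h)⟩)
    (fun {x z} h => propext ⟨fun hx => hclosed x hx z h, fun hz => hclosed z hz x (s.1.symm h)⟩)
  have hiff : ∀ x z, (r.1 ⊔ s.1) x z → (x ∈ C ↔ z ∈ C) := fun x z h => iff_of_eq (hK h)
  have : C = {x | (r.1 ⊔ s.1) x y} := hCA.antisymm fun x hx => (hiff x y hx).2 hyC
  rwa [← this]

theorem EulerianPartition.exists_isLUB [Finite E] (r s : D.EulerianPartition) :
    ∃ t, IsLUB {r, s} t := by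
  refine ⟨⟨r.1 ⊔ s.1, fun A hA => isEulerianSet_of_mem_classes_sup r s hA⟩, ?_, ?_⟩
  · rintro t (rfl | rfl)
    · exact (le_sup_left : t.1 ≤ t.1 ⊔ s.1)
    · exact (le_sup_right : t.1 ≤ r.1 ⊔ t.1)
  · intro t ht
    exact (sup_le (ht (Or.inl rfl)) (ht (Or.inr rfl)) : r.1 ⊔ s.1 ≤ t.1)

instance [Finite E] : Finite D.EulerianPartition :=
  Finite.of_injective (fun r : D.EulerianPartition => fun x y => r.1 x y) fun _ _ h =>
    Subtype.ext (Setoid.ext fun x y => iff_of_eq (congrFun (congrFun h x) y))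

/-- A finite partially ordered set with binary joins and a least element is a lattice. -/
theorem isLatticeOrder_of_exists_isLUB {P : Type*} [PartialOrder P] [Finite P]
    (hsup : ∀ x y : P, ∃ z, IsLUB {x, y} z) {b : P} (hb : ∀ x, b ≤ x) : IsLatticeOrder P := by
  refine fun x y => ⟨hsup x y, ?_⟩
  obtain ⟨z, hz, hmax⟩ := (Set.toFinite (lowerBounds {x, y})).exists_maximal ⟨b, fun w _ => hb w⟩
  refine ⟨z, hz, fun w hw => ?_⟩
  obtain ⟨t, ht⟩ := hsup z w
  -- The join of two lower bounds is a lower bound, so a maximal one is greatest.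
  have htl : t ∈ lowerBounds {x, y} := fun a ha => ht.2 (by
    rintro _ (rfl | rfl)
    · exact hz ha
    · exact hw ha)
  exact (ht.1 (Or.inr rfl)).trans (hmax htl (ht.1 (Or.inl rfl)))

theorem IsCyclePartition.exists_mem {P : Set (Cycle E)} (hP : D.IsCyclePartition P) (e : E) :
    ∃ c ∈ P, e ∈ edgesOf c := by
  have h : e ∈ ⋃ c ∈ P, edgesOf c := hP.2.2 ▸ Set.mem_univ e
  simpa using h

theorem IsCyclePartition.eq_of_mem {P : Set (Cycle E)} (hP : D.IsCyclePartition P) {c c' : Cycle E}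
    (hc : c ∈ P) (hc' : c' ∈ P) {e : E} (h : e ∈ edgesOf c) (h' : e ∈ edgesOf c') : c = c' :=
  by_contra fun hne => Set.disjoint_left.1 (hP.2.1 hc hc' hne) h h'

/-- The equivalence relation whose classes are the edge sets of a partition into cycles. -/
def IsCyclePartition.setoid {P : Set (Cycle E)} (hP : D.IsCyclePartition P) : Setoid E where
  r e f := ∃ c ∈ P, e ∈ edgesOf c ∧ f ∈ edgesOf c
  iseqv :=
    { refl := fun e => by
        obtain ⟨c, hc, he⟩ := hP.exists_mem e
        exact ⟨c, hc, he, he⟩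
      symm := fun ⟨c, hc, he, hf⟩ => ⟨c, hc, hf, he⟩
      trans := fun ⟨c, hc, he, hf⟩ ⟨c', hc', hf', hg⟩ =>
        ⟨c, hc, he, hP.eq_of_mem hc' hc hf' hf ▸ hg⟩ }

theorem IsCyclePartition.mem_classes_iff {P : Set (Cycle E)} (hP : D.IsCyclePartition P)
    {A : Set E} : A ∈ hP.setoid.classes ↔ ∃ c ∈ P, A = edgesOf c := by
  have key : ∀ c ∈ P, ∀ y ∈ edgesOf c, {x | hP.setoid x y} = edgesOf c := by
    intro c hc y hy
    ext x
    constructor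
    · rintro ⟨c', hc', hx, hy'⟩
      rwa [hP.eq_of_mem hc hc' hy hy']
    · exact fun hx => ⟨c, hc, hx, hy⟩
  constructor
  · rintro ⟨y, rfl⟩
    obtain ⟨c, hc, hy⟩ := hP.exists_mem y
    exact ⟨c, hc, key c hc y hy⟩
  · rintro ⟨c, hc, rfl⟩
    obtain ⟨y, hy⟩ := IsCycle.nonempty (hP.1 hc)
    exact ⟨y, (key c hc y hy).symm⟩

/-- A partition into cycles, as an element of the poset of Eulerian partitions. -/
def IsCyclePartition.eulerianPartition {P : Set (Cycle E)} (hP : D.IsCyclePartition P) :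
    D.EulerianPartition :=
  ⟨hP.setoid, fun _ hA => by
    obtain ⟨c, hc, rfl⟩ := hP.mem_classes_iff.1 hA
    exact ⟨c, (hP.1 hc).1, rfl⟩⟩

/-- A class of a finer Eulerian partition is successor-closed inside a cycle, hence the whole cycle.
-/
theorem IsCyclePartition.isMin {P : Set (Cycle E)} (hP : D.IsCyclePartition P) :
    IsMin hP.eulerianPartition := by
  intro z hz e f hef
  obtain ⟨c, hc, he, hf⟩ := hef
  obtain ⟨c', hc', hA⟩ := z.2 {x | z.1 x e} ⟨e, rfl⟩
  have hsub : {x | z.1 x e} ⊆ edgesOf c := by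
    intro x hx
    obtain ⟨c'', hc'', hx', he'⟩ := (show hP.setoid x e from hz hx)
    rwa [hP.eq_of_mem hc hc'' he he']
  have := (hP.1 hc).eq_of_succClosed (B := {x | z.1 x e}) ⟨e, z.1.refl e⟩ hsub (hA ▸ hc'.succClosed)
  rw [← this] at hf
  exact z.1.symm (show z.1 f e from hf)

theorem IsCyclePartition.eq_of_setoid_eq {P P' : Set (Cycle E)} (hP : D.IsCyclePartition P)
    (hP' : D.IsCyclePartition P') (h : hP.setoid = hP'.setoid) : P = P' := by
  have key : ∀ {P P' : Set (Cycle E)} (hP : D.IsCyclePartition P) (hP' : D.IsCyclePartition P'),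
      hP.setoid = hP'.setoid → P ⊆ P' := by
    intro P P' hP hP' h c hc
    have h1 := hP.mem_classes_iff.2 ⟨c, hc, rfl⟩
    rw [h, hP'.mem_classes_iff] at h1
    obtain ⟨c', hc', h2⟩ := h1
    rwa [(hP.1 hc).eq_of_edgesOf_eq (hP'.1 hc') h2]
  exact (key hP hP' h).antisymm (key hP' hP h.symm)

/-- Two partitions into cycles are minimal, so each equals their meet. -/
theorem existsUnique_isCyclePartition_of_isLatticeOrder [Fintype E]
    (h : ind (Set.univ : Set E) ∈ D.circulations) (hL : IsLatticeOrder D.EulerianPartition) :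
    ∃! P, D.IsCyclePartition P := by
  obtain ⟨P, hP⟩ := exists_cycles_of_ind_mem_circulations h
  refine ⟨P, hP, fun P' hP' => ?_⟩
  have hP : D.IsCyclePartition P := hP
  obtain ⟨-, z, hz, -⟩ := hL hP.eulerianPartition hP'.eulerianPartition
  have h1 := hP.isMin.eq_of_le (hz (Or.inl rfl))
  have h2 := hP'.isMin.eq_of_le (hz (Or.inr rfl))
  exact hP'.eq_of_setoid_eq hP (congrArg Subtype.val (h2.symm.trans h1))

/-- A class of `x` is balanced and so contains a cycle through each of its edges; there is only one
candidate. -/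
theorem IsCyclePartition.eulerianPartition_le [Fintype E] (hP : D.IsCyclePartition D.cycles)
    (x : D.EulerianPartition) : hP.eulerianPartition ≤ x := by
  rintro e f ⟨c, hc, he, hf⟩
  obtain ⟨c', hc', he', hsub⟩ := exists_isCycle_mem_of_ind_mem_circulations
    (x.2 {y | x.1 y e} ⟨e, rfl⟩).ind_mem_circulations (x.1.refl e)
  have := hP.eq_of_mem hc hc' he he'
  subst this
  exact x.1.symm (hsub hf)

theorem IsCyclePartition.isLatticeOrder_and_existsUnique_isMin [Fintype E]
    (hP : D.IsCyclePartition D.cycles) :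
    IsLatticeOrder D.EulerianPartition ∧ ∃! x : D.EulerianPartition, IsMin x :=
  ⟨isLatticeOrder_of_exists_isLUB EulerianPartition.exists_isLUB hP.eulerianPartition_le,
    hP.eulerianPartition, hP.isMin, fun _ hx => hx.eq_of_ge (hP.eulerianPartition_le _)⟩

/-! ### Cuts, unit flows and membership in the class S. -/

theorem IsConnected.exists_crossing (h : D.IsConnected) {W : Set V} (hne : W.Nonempty)
    (hW : W ≠ Set.univ) :
    ∃ e, (D.src e ∈ W ∧ D.tgt e ∉ W) ∨ (D.tgt e ∈ W ∧ D.src e ∉ W) := by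
  obtain ⟨x, hx⟩ := hne
  obtain ⟨y, hy⟩ := (Set.ne_univ_iff_exists_notMem W).1 hW
  obtain ⟨p⟩ := h.preconnected x y
  obtain ⟨d, -, h1, h2⟩ := p.exists_boundary_dart W hx hy
  obtain ⟨-, ⟨e, h3, h4⟩ | ⟨e, h3, h4⟩⟩ := (SimpleGraph.fromRel_adj _ _ _).1 d.adj
  · exact ⟨e, Or.inl ⟨h3 ▸ h1, h4 ▸ h2⟩⟩
  · exact ⟨e, Or.inr ⟨h4 ▸ h1, h3 ▸ h2⟩⟩

/-- Some edge crosses the cut, and by balance an entering edge forces a leaving one. -/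
theorem IsConnected.exists_leaving [Fintype V] [Fintype E] (h : D.IsConnected)
    (hE : ind (Set.univ : Set E) ∈ D.circulations) {W : Set V} (hne : W.Nonempty)
    (hW : W ≠ Set.univ) : ∃ e, D.src e ∈ W ∧ D.tgt e ∉ W := by
  classical
  by_contra! hcon
  obtain ⟨e, ⟨h1, h2⟩ | ⟨h1, h2⟩⟩ := h.exists_crossing hne hW
  · exact h2 (hcon e h1)
  have hc := cut_eq_zero hE W
  have hnn : ∀ i ∈ Finset.univ, (0 : ℚ) ≤ ind (Set.univ : Set E) i *
      ((if D.tgt i ∈ W then 1 else 0) - if D.src i ∈ W then 1 else 0) := by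
    intro i _
    rw [ind_of_mem (Set.mem_univ i), one_mul]
    by_cases hi : D.src i ∈ W
    · simp [hi, hcon i hi]
    · rw [if_neg hi, sub_zero]
      split_ifs <;> norm_num
  have := (Finset.sum_eq_zero_iff_of_nonneg hnn).1 hc e (Finset.mem_univ _)
  simp [h1, h2, ind_of_mem] at this

section Flow

variable [Fintype E]

open Classical in
/-- Some signed flow supported on the edge set `A` transports one unit from `x` to `y`. -/
def FlowConnected (D : MultiDigraph V E) (A : Set E) (x y : V) : Prop :=
  ∃ h : E → ℚ, (∀ e ∉ A, h e = 0) ∧ D.boundary h = Pi.single y (1 : ℚ) - Pi.single x 1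

theorem FlowConnected.refl (A : Set E) (x : V) : D.FlowConnected A x x :=
  ⟨0, fun _ _ => rfl, by simp⟩

theorem FlowConnected.symm {A : Set E} {x y : V} (h : D.FlowConnected A x y) :
    D.FlowConnected A y x := by
  obtain ⟨f, h1, h2⟩ := h
  exact ⟨-f, fun e he => by simp [h1 e he], by rw [map_neg, h2, neg_sub]⟩

theorem FlowConnected.trans {A : Set E} {x y z : V} (h : D.FlowConnected A x y)
    (h' : D.FlowConnected A y z) : D.FlowConnected A x z := by
  obtain ⟨f, h1, h2⟩ := h
  obtain ⟨g, h3, h4⟩ := h'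
  exact ⟨f + g, fun e he => by simp [h1 e he, h3 e he], by rw [map_add, h2, h4]; abel⟩

theorem FlowConnected.mono {A B : Set E} (hAB : A ⊆ B) {x y : V} (h : D.FlowConnected A x y) :
    D.FlowConnected B x y := by
  obtain ⟨f, h1, h2⟩ := h
  exact ⟨f, fun e he => h1 e fun h => he (hAB h), h2⟩

theorem FlowConnected.of_mem {A : Set E} {e : E} (he : e ∈ A) :
    D.FlowConnected A (D.src e) (D.tgt e) := by
  classical
  refine ⟨Pi.single e 1, fun f hf => ?_, by rw [boundary_single]⟩
  rw [Pi.single_apply, if_neg]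
  rintro rfl
  exact hf he

theorem IsCycle.flowConnected {c : Cycle E} (hc : D.IsCycle c) {x y : V}
    (hx : x ∈ D.src '' edgesOf c) (hy : y ∈ D.src '' edgesOf c) :
    D.FlowConnected (edgesOf c) x y := by
  obtain ⟨e, he, rfl⟩ := hx
  obtain ⟨f, hf, rfl⟩ := hy
  have := hc.eq_of_succClosed
    (B := {f | f ∈ edgesOf c ∧ D.FlowConnected (edgesOf c) (D.src e) (D.src f)})
    ⟨e, he, .refl _ _⟩ (fun _ h => h.1) (fun f hf => by
      obtain ⟨g, hg, hfg⟩ := hc.1.exists_succ hf.1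
      exact ⟨g, ⟨hg, hf.2.trans (hfg ▸ .of_mem hf.1)⟩, hfg⟩)
  rw [← this] at hf
  exact hf.2

theorem Sub.InS.flowConnected {H : D.Sub} (hH : H.InS) :
    ∀ x ∈ H.verts, ∀ y ∈ H.verts, D.FlowConnected H.edges x y := by
  induction hH with
  | cycle H h =>
    obtain ⟨c, hc, h1, h2⟩ := h
    rw [h1, h2]
    exact fun x hx y hy => IsCycle.flowConnected hc hx hy
  | glue H K v _ _ hv ihH ihK =>
    have hvm : v ∈ H.verts ∩ K.verts := hv ▸ Set.mem_singleton v
    have key : ∀ x ∈ (H.union K).verts, D.FlowConnected (H.union K).edges x v := by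
      rintro x (hx | hx)
      · exact (ihH x hx v hvm.1).mono Set.subset_union_left
      · exact (ihK x hx v hvm.2).mono Set.subset_union_right
    exact fun x hx y hy => (key x hx).trans (key y hy).symm

end Flow

theorem Sub.InS.exists_isCycle {H : D.Sub} (hH : H.InS) :
    ∀ e ∈ H.edges, ∃ c, D.IsCycle c ∧ e ∈ edgesOf c ∧ edgesOf c ⊆ H.edges := by
  induction hH with
  | cycle H h =>
    obtain ⟨c, hc, h1, -⟩ := h
    intro e he
    exact ⟨c, hc, h1 ▸ he, h1.symm.subset⟩
  | glue H K v _ _ _ ihH ihK =>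
    rintro e (he | he)
    · obtain ⟨c, hc, h1, h2⟩ := ihH e he
      exact ⟨c, hc, h1, h2.trans Set.subset_union_left⟩
    · obtain ⟨c, hc, h1, h2⟩ := ihK e he
      exact ⟨c, hc, h1, h2.trans Set.subset_union_right⟩

theorem Sub.InS.verts_nonempty {H : D.Sub} (hH : H.InS) : H.verts.Nonempty := by
  induction hH with
  | cycle H h =>
    obtain ⟨c, hc, -, h2⟩ := h
    rw [h2]
    exact (IsCycle.nonempty hc).image _
  | glue H K v _ _ _ ihH _ => exact ihH.mono Set.subset_union_left

/-- The subdigraph formed by the edges of a cycle. -/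
def cycleSub {c : Cycle E} (hc : D.IsCycle c) : D.Sub where
  verts := D.src '' edgesOf c
  edges := edgesOf c
  src_mem := fun e he => ⟨e, he, rfl⟩
  tgt_mem := fun e he => hc.src_image_eq_tgt_image ▸ ⟨e, he, rfl⟩

theorem cycleSub_inS {c : Cycle E} (hc : D.IsCycle c) : (cycleSub hc).InS :=
  .cycle _ ⟨c, hc, rfl, rfl⟩

/-- A member of S with maximal edge set must be all of `D`: otherwise a cycle through an outside
edge touching it could be glued on. -/
theorem memS_of_pairwiseDisjoint [Fintype E] [Nonempty E] (hconn : D.IsConnected)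
    (hE : ind (Set.univ : Set E) ∈ D.circulations) (hd : D.cycles.PairwiseDisjoint edgesOf) :
    D.MemS := by
  classical
  obtain ⟨e₀⟩ := ‹Nonempty E›
  obtain ⟨c₀, hc₀, -⟩ := exists_isCycle_mem_of_ind_mem_circulations hE (Set.mem_univ e₀)
  obtain ⟨_, ⟨H, hH, rfl⟩, hmax⟩ := (Set.toFinite {A : Set E | ∃ H : D.Sub, H.InS ∧ H.edges = A})
    |>.exists_maximal ⟨_, _, cycleSub_inS hc₀, rfl⟩
  by_contra hS
  obtain ⟨e, heH, hev⟩ : ∃ e ∉ H.edges, D.src e ∈ H.verts ∨ D.tgt e ∈ H.verts := by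
    by_cases hv : H.verts = Set.univ
    · have : H.edges ≠ Set.univ := by
        intro he
        apply hS
        have : D.whole = H := Sub.ext hv.symm he.symm
        rw [MemS, this]
        exact hH
      obtain ⟨e, he⟩ := (Set.ne_univ_iff_exists_notMem _).1 this
      exact ⟨e, he, Or.inl (hv ▸ Set.mem_univ _)⟩
    · obtain ⟨e, ⟨h1, h2⟩ | ⟨h1, h2⟩⟩ := hconn.exists_crossing hH.verts_nonempty hv
      · exact ⟨e, fun h => h2 (H.tgt_mem e h), Or.inl h1⟩
      · exact ⟨e, fun h => h2 (H.src_mem e h), Or.inr h1⟩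
  obtain ⟨c, hc, hec, -⟩ := exists_isCycle_mem_of_ind_mem_circulations hE (Set.mem_univ e)
  -- A shared edge lies on a cycle inside `H`, which would have to be `c`; but `e` is outside `H`.
  have hdisj : Disjoint H.edges (edgesOf c) := by
    refine Set.disjoint_left.2 fun f hfH hfc => ?_
    obtain ⟨c', hc', hfc', hsub⟩ := hH.exists_isCycle f hfH
    have : c = c' := by_contra fun hne => Set.disjoint_left.1 (hd hc hc' hne) hfc hfc'
    subst this
    exact heH (hsub hec)
  obtain ⟨v, hvH, hvc⟩ : ∃ v ∈ H.verts, v ∈ (cycleSub hc).verts := by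
    rcases hev with h | h
    · exact ⟨_, h, (cycleSub hc).src_mem e hec⟩
    · exact ⟨_, h, (cycleSub hc).tgt_mem e hec⟩
  have hinter : H.verts ∩ (cycleSub hc).verts = {v} := by
    refine Set.Subset.antisymm ?_ (Set.singleton_subset_iff.2 ⟨hvH, hvc⟩)
    rintro w ⟨hwH, hwc⟩
    by_contra hne
    have hne : w ≠ v := hne
    obtain ⟨f, hf, hfb⟩ := hc.flowConnected hvc hwc
    obtain ⟨g, hg, hgb⟩ := hH.flowConnected w hwH v hvH
    have hfg : f + g ∈ D.circulations := by
      change D.boundary (f + g) = 0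
      rw [map_add, hfb, hgb]
      abel
    -- On `c` the circulation `f + g` equals `f`, so `f` is constant there. A multiple of a cycle
    -- transports nothing, contradicting `v ≠ w`.
    have hconst : f = f e • ind (edgesOf c) := by
      ext a
      by_cases ha : a ∈ edgesOf c
      · have := eq_of_mem_circulations hE hd hfg hc ha hec
        have h1 := hg a (Set.disjoint_right.1 hdisj ha)
        have h2 := hg e (Set.disjoint_right.1 hdisj hec)
        simp only [Pi.add_apply, h1, h2, add_zero] at this
        simp [ind_of_mem ha, this]
      · simp [ind_of_notMem ha, hf a ha]
    have h0 : D.boundary f = 0 := by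
      have : D.boundary (ind (edgesOf c)) = 0 := ind_mem_circulations_of_isCircuit hc.1
      rw [hconst, map_smul, this, smul_zero]
    rw [h0] at hfb
    have := congrFun hfb w
    simp [hne] at this
  have hmem : H.edges ∪ edgesOf c ∈ {A : Set E | ∃ H : D.Sub, H.InS ∧ H.edges = A} :=
    ⟨_, .glue H (cycleSub hc) v hH (cycleSub_inS hc) hinter, rfl⟩
  exact heH (hmax hmem Set.subset_union_left (Or.inr hec))

/-! ### Counting cycles and linear independence. -/

theorem Sub.disjoint_edges {H K : D.Sub} {v : V} (hv : H.verts ∩ K.verts = {v}) :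
    Disjoint H.edges K.edges := by
  refine Set.disjoint_left.2 fun e h1 h2 => D.loopless e ?_
  have h3 : D.src e ∈ H.verts ∩ K.verts := ⟨H.src_mem e h1, K.src_mem e h2⟩
  have h4 : D.tgt e ∈ H.verts ∩ K.verts := ⟨H.tgt_mem e h1, K.tgt_mem e h2⟩
  rw [hv] at h3 h4
  exact h3.trans h4.symm

/-- The part of `c` in `H` is balanced away from `v`, hence also at `v` since net inflows sum to
zero. By minimality it is empty or all of `c`. -/
theorem IsCycle.subset_or_subset [Fintype V] [Fintype E] {H K : D.Sub} {v : V}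
    (hv : H.verts ∩ K.verts = {v}) {c : Cycle E} (hc : D.IsCycle c)
    (h : edgesOf c ⊆ H.edges ∪ K.edges) : edgesOf c ⊆ H.edges ∨ edgesOf c ⊆ K.edges := by
  classical
  have hcirc : D.boundary (ind (edgesOf c)) = 0 := ind_mem_circulations_of_isCircuit hc.1
  have hne : ∀ x, x ≠ v → D.boundary (ind (edgesOf c ∩ H.edges)) x = 0 := by
    intro x hx
    by_cases hxH : x ∈ H.verts
    · have hxK : x ∉ K.verts := fun hxK => hx (show x ∈ ({v} : Set V) from hv ▸ ⟨hxH, hxK⟩)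
      have h0 := congrFun hcirc x
      rw [boundary_apply_apply, Pi.zero_apply] at h0
      rw [boundary_apply_apply]
      refine Eq.trans ?_ h0
      refine Finset.sum_congr rfl fun e _ => ?_
      by_cases hec : e ∈ edgesOf c
      · rcases h hec with heH | heK
        · rw [ind_of_mem hec, ind_of_mem (show e ∈ edgesOf c ∩ H.edges from ⟨hec, heH⟩)]
        · rw [if_neg (fun h' : D.tgt e = x => hxK (h' ▸ K.tgt_mem e heK)),
            if_neg (fun h' : D.src e = x => hxK (h' ▸ K.src_mem e heK))]
          simp
      · rw [ind_of_notMem hec, ind_of_notMem (fun h' : e ∈ edgesOf c ∩ H.edges => hec h'.1)]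
    · rw [boundary_apply_apply]
      refine Finset.sum_eq_zero fun e _ => ?_
      by_cases heH : e ∈ H.edges
      · rw [if_neg (fun h' : D.tgt e = x => hxH (h' ▸ H.tgt_mem e heH)),
          if_neg (fun h' : D.src e = x => hxH (h' ▸ H.src_mem e heH))]
        simp
      · rw [ind_of_notMem (fun h' : e ∈ edgesOf c ∩ H.edges => heH h'.2), zero_mul]
  have hA : ind (edgesOf c ∩ H.edges) ∈ D.circulations := by
    have hs := sum_boundary (D := D) (ind (edgesOf c ∩ H.edges)) Set.univ
    simp only [Set.toFinset_univ, Set.mem_univ, if_true, sub_self, mul_zero,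
      Finset.sum_const_zero] at hs
    rw [Finset.sum_eq_single v (fun x _ hx => hne x hx) (by simp)] at hs
    change D.boundary _ = 0
    ext x
    by_cases hx : x = v
    · rw [hx]; exact hs
    · exact hne x hx
  rcases (edgesOf c ∩ H.edges).eq_empty_or_nonempty with hemp | hnon
  · right
    intro e he
    exact (h he).resolve_left fun heH => (hemp ▸ ⟨he, heH⟩ : e ∈ (∅ : Set E))
  · left
    rw [← hc.eq_of_succClosed hnon Set.inter_subset_left (succClosed_of_ind_mem_circulations hA)]
    exact Set.inter_subset_right

theorem Sub.InS.ncard_cycles [Fintype V] [Fintype E] {H : D.Sub} (hH : H.InS) :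
    {c ∈ D.cycles | edgesOf c ⊆ H.edges}.ncard + H.verts.ncard = H.edges.ncard + 1 := by
  induction hH with
  | cycle H h =>
    obtain ⟨c, hc, h1, h2⟩ := h
    have hs : {c' ∈ D.cycles | edgesOf c' ⊆ H.edges} = {c} := by
      ext c'
      constructor
      · rintro ⟨h3, h4⟩
        exact IsCycle.eq_of_subset h3 hc (h1 ▸ h4)
      · rintro rfl
        exact ⟨hc, h1.symm.subset⟩
    rw [hs, h1, h2, (IsCycle.src_injOn hc).ncard_image, Set.ncard_singleton, add_comm]
  | glue H K v _ _ hv ihH ihK =>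
    have hd := Sub.disjoint_edges hv
    have hfin : ∀ A : Set E, {c ∈ D.cycles | edgesOf c ⊆ A}.Finite := fun A =>
      D.cycles_finite.subset fun c hc => hc.1
    have hs : {c ∈ D.cycles | edgesOf c ⊆ (H.union K).edges} =
        {c ∈ D.cycles | edgesOf c ⊆ H.edges} ∪ {c ∈ D.cycles | edgesOf c ⊆ K.edges} := by
      ext c
      constructor
      · rintro ⟨h1, h2⟩
        exact (IsCycle.subset_or_subset hv h1 h2).imp (fun h => ⟨h1, h⟩) (fun h => ⟨h1, h⟩)
      · rintro (⟨h1, h2⟩ | ⟨h1, h2⟩)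
        · exact ⟨h1, h2.trans Set.subset_union_left⟩
        · exact ⟨h1, h2.trans Set.subset_union_right⟩
    have hcd : Disjoint {c ∈ D.cycles | edgesOf c ⊆ H.edges}
        {c ∈ D.cycles | edgesOf c ⊆ K.edges} := by
      refine Set.disjoint_left.2 fun c h1 h2 => ?_
      obtain ⟨e, he⟩ := IsCycle.nonempty h1.1
      exact Set.disjoint_left.1 hd (h1.2 he) (h2.2 he)
    have h1 := Set.ncard_union_eq hcd (hfin _) (hfin _)
    have h2 := Set.ncard_union_eq hd
    have h3 := Set.ncard_union_add_ncard_inter H.verts K.verts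
    rw [hv, Set.ncard_singleton] at h3
    rw [hs, h1]
    change _ + (H.verts ∪ K.verts).ncard = (H.edges ∪ K.edges).ncard + 1
    omega

theorem MemS.ncard_cycles [Fintype V] [Fintype E] (h : D.MemS) :
    (D.cycles.ncard : ℤ) = (Fintype.card E : ℤ) - (Fintype.card V : ℤ) + 1 := by
  have := Sub.InS.ncard_cycles h
  have hs : {c ∈ D.cycles | edgesOf c ⊆ D.whole.edges} = D.cycles := by
    ext c
    exact ⟨fun h => h.1, fun h => ⟨h, Set.subset_univ _⟩⟩
  have h1 : D.whole.verts.ncard = Fintype.card V := by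
    rw [← Nat.card_eq_fintype_card]; exact Set.ncard_univ V
  have h2 : D.whole.edges.ncard = Fintype.card E := by
    rw [← Nat.card_eq_fintype_card]; exact Set.ncard_univ E
  rw [hs, h1, h2] at this
  omega

/-- The cycles span a space whose dimension is at least their number. -/
theorem linearIndependent_of_ncard_cycles [Fintype V] [Nonempty V] [Fintype E]
    (hE : ind (Set.univ : Set E) ∈ D.circulations)
    (h : (D.cycles.ncard : ℤ) = (Fintype.card E : ℤ) - (Fintype.card V : ℤ) + 1) :
    LinearIndependent ℚ fun c : D.cycles => ind (edgesOf c.1) := by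
  have := D.cycles_finite.fintype
  rw [linearIndependent_iff_card_le_finrank_span]
  have h1 := card_le_finrank_circulations (D := D)
  have h2 : Set.range (fun c : D.cycles => ind (edgesOf c.1)) =
      (fun c => ind (edgesOf c)) '' D.cycles := by
    rw [Set.image_eq_range]
  rw [h2, Set.finrank, ← circulations_eq_span hE, ← Nat.card_eq_fintype_card]
  rw [← h] at h1
  exact_mod_cast h1

open Classical in
theorem IsCyclePartition.sum_ind [Fintype E] [Fintype D.cycles] {P : Set (Cycle E)}
    (hP : D.IsCyclePartition P) :
    ∑ c : D.cycles, (if c.1 ∈ P then (1 : ℚ) else 0) • ind (edgesOf c.1) = ind Set.univ := by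
  ext e
  rw [Finset.sum_apply, ind_of_mem (Set.mem_univ e)]
  obtain ⟨c, hc, he⟩ := hP.exists_mem e
  rw [Finset.sum_eq_single (⟨c, hP.1 hc⟩ : D.cycles)]
  · simp [hc, ind_of_mem he]
  · intro c' _ hne
    by_cases hc' : c'.1 ∈ P
    · have : e ∉ edgesOf c'.1 := fun h => hne (Subtype.ext (hP.eq_of_mem hc' hc h he))
      simp [ind_of_notMem this]
    · simp [hc']
  · simp

theorem existsUnique_isCyclePartition_of_linearIndependent [Fintype E]
    (hE : ind (Set.univ : Set E) ∈ D.circulations)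
    (h : LinearIndependent ℚ fun c : D.cycles => ind (edgesOf c.1)) :
    ∃! P, D.IsCyclePartition P := by
  classical
  obtain ⟨P, hP⟩ := exists_cycles_of_ind_mem_circulations hE
  have hP : D.IsCyclePartition P := hP
  refine ⟨P, hP, fun P' hP' => ?_⟩
  have := D.cycles_finite.fintype
  have h0 := Fintype.linearIndependent_iff.1 h
    (fun c => (if c.1 ∈ P' then (1 : ℚ) else 0) - if c.1 ∈ P then 1 else 0) (by
      simp_rw [sub_smul]
      rw [Finset.sum_sub_distrib, hP.sum_ind, hP'.sum_ind, sub_self])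
  ext c
  constructor
  · intro hc
    by_contra hc'
    have := h0 ⟨c, hP'.1 hc⟩
    simp [hc, hc'] at this
  · intro hc
    by_contra hc'
    have := h0 ⟨c, hP.1 hc⟩
    simp [hc, hc'] at this

/-! ### Arborescences: uniqueness in a cactus, and existence. -/

/-- The vertex `y` can be reached from `x` along edges in `T`. -/
abbrev Reach (D : MultiDigraph V E) (T : Set E) : V → V → Prop :=
  Relation.ReflTransGen fun x y => ∃ e ∈ T, D.src e = x ∧ D.tgt e = y

theorem Reach.step {T : Set E} {x : V} {e : E} (h : D.Reach T x (D.src e)) (he : e ∈ T) :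
    D.Reach T x (D.tgt e) :=
  h.tail ⟨e, he, rfl, rfl⟩

/-- The edge set `T` is a spanning arborescence of the subdigraph `H`, rooted at `u`. -/
structure Sub.IsArborescence (H : D.Sub) (u : V) (T : Set E) : Prop where
  subset : T ⊆ H.edges
  tgt_ne : ∀ e ∈ T, D.tgt e ≠ u
  existsUnique : ∀ v ∈ H.verts, v ≠ u → ∃! e, e ∈ T ∧ D.tgt e = v
  reach : ∀ v ∈ H.verts, D.Reach T u v

theorem isArborescence_whole_iff {u : V} {T : Set E} :
    D.whole.IsArborescence u T ↔ D.IsArborescence u T :=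
  ⟨fun h => ⟨h.tgt_ne, fun v => h.existsUnique v trivial, fun v => h.reach v trivial⟩,
    fun h => ⟨fun _ _ => trivial, h.1, fun v _ => h.2.1 v, fun v _ => h.2.2 v⟩⟩

theorem Sub.union_comm (H K : D.Sub) : H.union K = K.union H :=
  Sub.ext (Set.union_comm _ _) (Set.union_comm _ _)

theorem Sub.IsArborescence.inter_of_union {H K : D.Sub} {u v : V} {T : Set E}
    (hv : H.verts ∩ K.verts = {v}) (hT : (H.union K).IsArborescence u T) (hu : u ∈ H.verts) :
    H.IsArborescence u (T ∩ H.edges) ∧ K.IsArborescence v (T ∩ K.edges) := by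
  have hvH : v ∈ H.verts := (hv ▸ Set.mem_singleton v : v ∈ H.verts ∩ K.verts).1
  have hvK : v ∈ K.verts := (hv ▸ Set.mem_singleton v : v ∈ H.verts ∩ K.verts).2
  have heq : ∀ x, x ∈ H.verts → x ∈ K.verts → x = v := fun x h1 h2 =>
    (hv ▸ ⟨h1, h2⟩ : x ∈ ({v} : Set V))
  -- A walk from `u` passes between `H` and `K` only at `v`, so its `H`-steps and `K`-steps can be
  -- separated there.
  have key : ∀ x, D.Reach T u x → (x ∈ H.verts → D.Reach (T ∩ H.edges) u x) ∧
      (x ∈ K.verts → D.Reach (T ∩ H.edges) u v ∧ D.Reach (T ∩ K.edges) v x) := by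
    intro x hx
    induction hx with
    | refl =>
      refine ⟨fun _ => .refl, fun h => ?_⟩
      obtain rfl := heq u hu h
      exact ⟨.refl, .refl⟩
    | tail _ hstep ih =>
      obtain ⟨e, he, rfl, rfl⟩ := hstep
      rcases hT.subset he with heH | heK
      · have h1 := Reach.step (ih.1 (H.src_mem e heH)) ⟨he, heH⟩
        refine ⟨fun _ => h1, fun h => ?_⟩
        rw [heq _ (H.tgt_mem e heH) h] at h1 ⊢
        exact ⟨h1, .refl⟩
      · have h1 := ih.2 (K.src_mem e heK)
        refine ⟨fun h => ?_, fun _ => ⟨h1.1, h1.2.step ⟨he, heK⟩⟩⟩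
        rw [heq _ h (K.tgt_mem e heK)]
        exact h1.1
  -- If `v ≠ u`, the only edge of `T` entering `v` ends a walk within `H`.
  have hKv : ∀ e ∈ T ∩ K.edges, D.tgt e ≠ v := by
    rintro e ⟨heT, heK⟩ hev
    have hne : v ≠ u := hev ▸ hT.tgt_ne e heT
    obtain ⟨_, -, f, hf, -, hfv⟩ :=
      ((key v (hT.reach v (Or.inl hvH))).1 hvH).cases_tail.resolve_left hne
    have := (hT.existsUnique v (Or.inl hvH) hne).unique ⟨heT, hev⟩ ⟨hf.1, hfv⟩
    subst this
    exact Set.disjoint_left.1 (Sub.disjoint_edges hv) hf.2 heK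
  refine ⟨⟨Set.inter_subset_right, fun e he => hT.tgt_ne e he.1, ?_, ?_⟩,
    ⟨Set.inter_subset_right, hKv, ?_, ?_⟩⟩
  · intro x hx hxu
    obtain ⟨e, ⟨heT, hex⟩, huniq⟩ := hT.existsUnique x (Or.inl hx) hxu
    refine ⟨e, ⟨⟨heT, (hT.subset heT).resolve_right fun heK => ?_⟩, hex⟩,
      fun f hf => huniq f ⟨hf.1.1, hf.2⟩⟩
    exact hKv e ⟨heT, heK⟩ (heq _ (hex ▸ hx) (K.tgt_mem e heK))
  · exact fun x hx => (key x (hT.reach x (Or.inl hx))).1 hx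
  · intro x hx hxv
    have hxu : x ≠ u := by
      rintro rfl
      exact hxv (heq x hu hx)
    obtain ⟨e, ⟨heT, hex⟩, huniq⟩ := hT.existsUnique x (Or.inr hx) hxu
    refine ⟨e, ⟨⟨heT, (hT.subset heT).resolve_left fun heH => ?_⟩, hex⟩,
      fun f hf => huniq f ⟨hf.1.1, hf.2⟩⟩
    exact hxv (heq x (hex ▸ H.tgt_mem e heH) hx)
  · exact fun x hx => ((key x (hT.reach x (Or.inr hx))).2 hx).2

theorem IsCycle.tgt_injOn {c : Cycle E} (hc : D.IsCycle c) : Set.InjOn D.tgt (edgesOf c) := by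
  induction c using Quotient.inductionOn' with
  | h l =>
  cases l with
  | nil => exact absurd rfl hc.2.1
  | cons a l =>
  have hch : Cycle.Chain (fun e f => D.tgt e = D.src f) ((a :: l : List E) : Cycle E) := hc.1.2
  rw [Cycle.chain_coe_cons] at hch
  have hn : ((a :: l).map D.src).Nodup := hc.2.2
  -- The list of targets is the list of sources shifted by one place.
  have key : ∀ (l : List E) (a b : E),
      List.IsChain (fun e f => D.tgt e = D.src f) (a :: (l ++ [b])) →
      (a :: l).map D.tgt = (l ++ [b]).map D.src := by
    intro l
    induction l with
    | nil => intro a b h; simpa using h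
    | cons x l ih =>
      intro a b h
      rw [List.cons_append, List.isChain_cons_cons] at h
      rw [List.map_cons, ih x b h.2, h.1, List.cons_append, List.map_cons]
  have h1 : ((a :: l).map D.tgt).Nodup := by
    rw [key l a a hch]
    refine List.Perm.nodup ?_ hn
    exact (List.perm_append_singleton a l).symm.map D.src
  intro x hx y hy hxy
  exact List.inj_on_of_nodup_map h1 hx hy hxy

theorem Sub.InS.isArborescence_unique {H : D.Sub} (hH : H.InS) :
    ∀ u ∈ H.verts, ∀ T T', H.IsArborescence u T → H.IsArborescence u T' → T = T' := by
  induction hH with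
  | cycle H h =>
    obtain ⟨c, hc, h1, h2⟩ := h
    have key : ∀ u T, H.IsArborescence u T → T = {e ∈ edgesOf c | D.tgt e ≠ u} := by
      intro u T hT
      ext e
      constructor
      · exact fun he => ⟨h1 ▸ hT.subset he, hT.tgt_ne e he⟩
      · rintro ⟨hec, heu⟩
        obtain ⟨f, ⟨hf, hfe⟩, -⟩ := hT.existsUnique (D.tgt e) (H.tgt_mem e (h1 ▸ hec)) heu
        rwa [← IsCycle.tgt_injOn hc (h1 ▸ hT.subset hf) hec hfe]
    exact fun u _ T T' hT hT' => (key u T hT).trans (key u T' hT').symm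
  | glue H K v _ _ hv ihH ihK =>
    have key : ∀ {H K : D.Sub},
        (∀ u ∈ H.verts, ∀ T T', H.IsArborescence u T → H.IsArborescence u T' → T = T') →
        (∀ u ∈ K.verts, ∀ T T', K.IsArborescence u T → K.IsArborescence u T' → T = T') →
        H.verts ∩ K.verts = {v} → ∀ u ∈ H.verts, ∀ T T', (H.union K).IsArborescence u T →
        (H.union K).IsArborescence u T' → T = T' := by
      intro H K ihH ihK hv u hu T T' hT hT'
      have hvK : v ∈ K.verts := (hv ▸ Set.mem_singleton v : v ∈ H.verts ∩ K.verts).2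
      have h1 := hT.inter_of_union hv hu
      have h2 := hT'.inter_of_union hv hu
      have h3 := ihH u hu _ _ h1.1 h2.1
      have h4 := ihK v hvK _ _ h1.2 h2.2
      have h5 : ∀ T, T ⊆ (H.union K).edges → T = T ∩ H.edges ∪ T ∩ K.edges := fun T hT => by
        rw [← Set.inter_union_distrib_left]
        exact (Set.inter_eq_left.2 hT).symm
      rw [h5 T hT.subset, h5 T' hT'.subset, h3, h4]
    rintro u (hu | hu)
    · exact key ihH ihK hv u hu
    · rw [Sub.union_comm]
      exact key ihK ihH (by rw [Set.inter_comm, hv]) u hu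

/-- A tree on a maximal vertex set spans, since an edge leaving that set would extend it. -/
theorem IsConnected.exists_isArborescence [Fintype V] [Fintype E] (hconn : D.IsConnected)
    (hE : ind (Set.univ : Set E) ∈ D.circulations) (u : V) : ∃ T, D.IsArborescence u T := by
  let F : Set (Set V) := {W | u ∈ W ∧ ∃ T : Set E, (∀ e ∈ T, D.tgt e ≠ u) ∧
    (∀ v ∈ W, v ≠ u → ∃! e, e ∈ T ∧ D.tgt e = v) ∧ (∀ e ∈ T, D.tgt e ∈ W) ∧
    ∀ v ∈ W, D.Reach T u v}
  have hF : F.Nonempty := by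
    refine ⟨{u}, rfl, ∅, by simp, fun v hv hvu => absurd hv hvu, by simp, ?_⟩
    rintro v rfl
    exact .refl
  obtain ⟨W, ⟨huW, T, h1, h2, h3, h4⟩, hmax⟩ := (Set.toFinite F).exists_maximal hF
  have hW : W = Set.univ := by
    by_contra hW
    obtain ⟨e, he, he'⟩ := hconn.exists_leaving hE ⟨u, huW⟩ hW
    have hmono : ∀ v, D.Reach T u v → D.Reach (insert e T) u v := fun v hv =>
      Relation.ReflTransGen.mono (fun x y ⟨f, hf, hxy⟩ => ⟨f, Or.inr hf, hxy⟩) _ _ hv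
    have hmem : insert (D.tgt e) W ∈ F := by
      refine ⟨Or.inr huW, insert e T, ?_, ?_, ?_, ?_⟩
      · rintro f (rfl | hf)
        · rintro h
          exact he' (h ▸ huW)
        · exact h1 f hf
      · rintro v (rfl | hv) hvu
        · refine ⟨e, ⟨Or.inl rfl, rfl⟩, ?_⟩
          rintro f ⟨rfl | hf, hfe⟩
          · rfl
          · exact absurd (hfe ▸ h3 f hf) he'
        · obtain ⟨f, hf, huniq⟩ := h2 v hv hvu
          refine ⟨f, ⟨Or.inr hf.1, hf.2⟩, ?_⟩
          rintro g ⟨rfl | hg, hgv⟩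
          · exact absurd (hgv ▸ hv) he'
          · exact huniq g ⟨hg, hgv⟩
      · rintro f (rfl | hf)
        · exact Or.inl rfl
        · exact Or.inr (h3 f hf)
      · rintro v (rfl | hv)
        · exact Reach.step (hmono _ (h4 _ he)) (Or.inl rfl)
        · exact hmono _ (h4 v hv)
    exact he' (hmax hmem (Set.subset_insert _ _) (Or.inl rfl))
  subst hW
  exact ⟨T, h1, fun v => h2 v trivial, fun v => h4 v trivial⟩

theorem MemS.existsUnique_isArborescence [Fintype V] [Fintype E] (h : D.MemS)
    (hconn : D.IsConnected) (hE : ind (Set.univ : Set E) ∈ D.circulations) (u : V) :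
    ∃! T, D.IsArborescence u T := by
  obtain ⟨T, hT⟩ := hconn.exists_isArborescence hE u
  exact ⟨T, hT, fun T' hT' => Sub.InS.isArborescence_unique h u trivial T' T
    (isArborescence_whole_iff.2 hT') (isArborescence_whole_iff.2 hT)⟩

/-! ### A unique arborescence forces edge-disjoint cycles. -/

namespace IsArborescence

variable {u : V} {T : Set E}

theorem eq_of_tgt_eq (hT : D.IsArborescence u T) {e f : E} (he : e ∈ T) (hf : f ∈ T)
    (h : D.tgt e = D.tgt f) : e = f :=
  (hT.2.1 (D.tgt f) (hT.1 f hf)).unique ⟨he, h⟩ ⟨hf, rfl⟩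

/-- A tree path to the target of a tree edge `e` passes through its source. -/
theorem reach_src (hT : D.IsArborescence u T) {e : E} (he : e ∈ T) {v : V}
    (h : D.Reach T v (D.tgt e)) (hne : v ≠ D.tgt e) : D.Reach T v (D.src e) := by
  obtain ⟨x, hx, f, hf, rfl, hfe⟩ := h.cases_tail.resolve_left hne.symm
  rwa [hT.eq_of_tgt_eq hf he hfe] at hx

/-- A directed cycle in the tree could be pushed back edge by edge to the root, which no tree edge
enters. -/
theorem not_reach_src (hT : D.IsArborescence u T) {x : V} (hx : D.Reach T u x) :
    ∀ e ∈ T, D.tgt e = x → ¬ D.Reach T x (D.src e) := by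
  induction hx with
  | refl => exact fun e he h => absurd h (hT.1 e he)
  | tail _ hstep ih =>
    obtain ⟨f, hf, rfl, rfl⟩ := hstep
    intro e he h hr
    obtain rfl := hT.eq_of_tgt_eq he hf h
    rcases hr.cases_tail with h' | ⟨y, hy, g, hg, rfl, hge⟩
    · exact D.loopless e h'
    · refine ih g hg hge ?_
      exact (Relation.ReflTransGen.single ⟨e, he, rfl, rfl⟩).trans hy

theorem reach_of_notMem (hT : D.IsArborescence u T) (huniq : ∀ T', D.IsArborescence u T' → T' = T)
    {e : E} (he : e ∉ T) : D.Reach T (D.tgt e) (D.src e) := by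
  by_cases heu : D.tgt e = u
  · rw [heu]; exact hT.2.2 _
  by_contra hr
  obtain ⟨f, ⟨hf, hfe⟩, -⟩ := hT.2.1 (D.tgt e) heu
  -- Were the source of `e` no descendant of its target, `e` could replace the tree edge `f` with
  -- the same target: tree paths to non-descendants avoid `f`.
  have hT' : D.IsArborescence u (insert e (T \ {f})) := by
    have hmain : ∀ z, D.Reach T u z → ¬ D.Reach T (D.tgt e) z →
        D.Reach (insert e (T \ {f})) u z := by
      intro z hz
      induction hz with
      | refl => exact fun _ => .refl
      | tail _ hstep ih =>
        obtain ⟨g, hg, rfl, rfl⟩ := hstep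
        intro hn
        refine Reach.step (ih fun h => hn (h.step hg)) (Or.inr ⟨hg, ?_⟩)
        rintro rfl
        exact hn (hfe ▸ .refl)
    have hy : D.Reach (insert e (T \ {f})) u (D.tgt e) :=
      Reach.step (hmain _ (hT.2.2 _) hr) (Or.inl rfl)
    refine ⟨?_, ?_, ?_⟩
    · rintro g (rfl | hg)
      · exact heu
      · exact hT.1 g hg.1
    · intro v hv
      by_cases hve : D.tgt e = v
      · refine ⟨e, ⟨Or.inl rfl, hve⟩, ?_⟩
        rintro g ⟨rfl | hg, hgv⟩
        · rfl
        · exact absurd (hT.eq_of_tgt_eq hg.1 hf (hgv.trans (hve.symm.trans hfe.symm))) hg.2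
      · obtain ⟨g, ⟨hg, hgv⟩, hgu⟩ := hT.2.1 v hv
        refine ⟨g, ⟨Or.inr ⟨hg, ?_⟩, hgv⟩, ?_⟩
        · rintro rfl
          exact hve (hfe.symm.trans hgv)
        · rintro g' ⟨rfl | hg', hg'v⟩
          · exact absurd hg'v hve
          · exact hgu g' ⟨hg'.1, hg'v⟩
    · intro v
      by_cases hv : D.Reach T (D.tgt e) v
      · induction hv with
        | refl => exact hy
        | tail _ hstep ih =>
          obtain ⟨g, hg, rfl, rfl⟩ := hstep
          by_cases hgf : g = f
          · rw [hgf, hfe]; exact hy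
          · exact Reach.step ih (Or.inr ⟨hg, hgf⟩)
      · exact hmain v (hT.2.2 v) hv
  exact he (huniq _ hT' ▸ Or.inl rfl)

/-- The only edge entering the set of descendants of the target of a tree edge is that edge. -/
theorem eq_of_enters (hT : D.IsArborescence u T) (huniq : ∀ T', D.IsArborescence u T' → T' = T)
    {e f : E} (he : e ∈ T) (h1 : D.Reach T (D.tgt e) (D.tgt f))
    (h2 : ¬ D.Reach T (D.tgt e) (D.src f)) : f = e := by
  by_cases hf : f ∈ T
  · by_cases heq : D.tgt e = D.tgt f
    · exact (hT.eq_of_tgt_eq he hf heq).symm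
    · exact absurd (hT.reach_src hf h1 heq) h2
  · exact absurd (h1.trans (hT.reach_of_notMem huniq hf)) h2

theorem cut_eq [Fintype V] [Fintype E] (hT : D.IsArborescence u T)
    (huniq : ∀ T', D.IsArborescence u T' → T' = T) (hE : ind (Set.univ : Set E) ∈ D.circulations)
    {e : E} (he : e ∈ T) : ∃ b, D.Reach T (D.tgt e) (D.src b) ∧ ¬ D.Reach T (D.tgt e) (D.tgt b) ∧
      (∀ b', D.Reach T (D.tgt e) (D.src b') → ¬ D.Reach T (D.tgt e) (D.tgt b') → b' = b) ∧
      ∀ f ∈ D.circulations, f e = f b := by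
  classical
  set S : Set V := {x | D.Reach T (D.tgt e) x} with hS
  set O : Finset E := {b | D.src b ∈ S ∧ D.tgt b ∉ S} with hO
  have hsrc : D.src e ∉ S := hT.not_reach_src (hT.2.2 _) e he rfl
  have htgt : D.tgt e ∈ S := Relation.ReflTransGen.refl
  have key : ∀ f ∈ D.circulations, f e = ∑ b ∈ O, f b := by
    intro f hf
    have hc := cut_eq_zero hf S
    have : ∀ i, f i * ((if D.tgt i ∈ S then 1 else 0) - if D.src i ∈ S then 1 else 0) =
        (if i = e then f i else 0) - if i ∈ O then f i else 0 := by
      intro i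
      by_cases h1 : D.tgt i ∈ S <;> by_cases h2 : D.src i ∈ S
      · have : i ≠ e := by rintro rfl; exact hsrc h2
        simp [h1, h2, hO, this]
      · have : i = e := hT.eq_of_enters huniq he h1 h2
        simp [hO, this, htgt, hsrc]
      · have : i ≠ e := by rintro rfl; exact hsrc h2
        simp [h1, h2, hO, this]
      · have : i ≠ e := by rintro rfl; exact h1 htgt
        simp [h1, h2, hO, this]
    simp_rw [this] at hc
    rw [Finset.sum_sub_distrib, Finset.sum_ite_eq' Finset.univ e, Finset.sum_ite_mem] at hc
    simp only [Finset.mem_univ, if_true, Finset.univ_inter] at hc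
    linarith
  -- For the all-ones circulation the cut identity counts the leaving edges: there is exactly one.
  have h1 := key _ hE
  rw [ind_of_mem (Set.mem_univ e), Finset.sum_congr rfl fun b _ => ind_of_mem (Set.mem_univ b),
    Finset.sum_const, nsmul_eq_mul, mul_one] at h1
  obtain ⟨b, hb⟩ := Finset.card_eq_one.1 (by exact_mod_cast h1.symm : O.card = 1)
  have hbO : b ∈ O := hb ▸ Finset.mem_singleton_self b
  have hbO' : D.src b ∈ S ∧ D.tgt b ∉ S := by simpa [hO] using hbO
  refine ⟨b, hbO'.1, hbO'.2, fun b' h1 h2 => ?_, fun f hf => ?_⟩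
  · have : b' ∈ O := by
      rw [hO, Finset.mem_filter]
      exact ⟨Finset.mem_univ _, h1, h2⟩
    rw [hb] at this
    exact Finset.mem_singleton.1 this
  · rw [key f hf, hb, Finset.sum_singleton]

theorem mem_iff_of_leaves [Fintype V] [Fintype E] (hT : D.IsArborescence u T)
    (huniq : ∀ T', D.IsArborescence u T' → T' = T) (hE : ind (Set.univ : Set E) ∈ D.circulations)
    {e b : E} (he : e ∈ T) (h1 : D.Reach T (D.tgt e) (D.src b))
    (h2 : ¬ D.Reach T (D.tgt e) (D.tgt b)) {A : Set E} (hA : ind A ∈ D.circulations) :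
    e ∈ A ↔ b ∈ A := by
  obtain ⟨b', -, -, h3, h4⟩ := hT.cut_eq huniq hE he
  obtain rfl := h3 b h1 h2
  have h := h4 _ hA
  by_cases h5 : e ∈ A <;> by_cases h6 : b ∈ A
  · simp [h5, h6]
  · simp [ind_of_mem h5, ind_of_notMem h6] at h
  · simp [ind_of_notMem h5, ind_of_mem h6] at h
  · simp [h5, h6]

/-- The first edge of a nontrivial tree path. -/
theorem exists_first_edge {x y : V} (h : D.Reach T x y) (hne : x ≠ y) :
    ∃ e ∈ T, D.src e = x ∧ D.Reach T (D.tgt e) y := by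
  obtain ⟨z, ⟨e, he, h1, rfl⟩, h2⟩ := h.cases_head.resolve_left hne
  exact ⟨e, he, h1, h2⟩

/-- If there is only one arborescence rooted at `u`, an edge outside of it lies in only one
cycle. -/
theorem eq_of_mem_of_notMem [Fintype V] [Fintype E] (hT : D.IsArborescence u T)
    (huniq : ∀ T', D.IsArborescence u T' → T' = T) (hE : ind (Set.univ : Set E) ∈ D.circulations)
    {b : E} (hb : b ∉ T) {c c' : Cycle E} (hc : D.IsCycle c) (hc' : D.IsCycle c')
    (h : b ∈ edgesOf c) (h' : b ∈ edgesOf c') : c = c' := by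
  -- The fundamental cycle of `b`: the tree path from its target to its source, closed by `b`. For
  -- each tree edge on it, `b` leaves the subtree below, so any cycle through `b` contains `B`.
  let B : Set E := {e | e = b ∨ e ∈ T ∧ D.Reach T (D.tgt b) (D.src e) ∧
    D.Reach T (D.tgt e) (D.src b)}
  have hsub : ∀ {c : Cycle E}, D.IsCycle c → b ∈ edgesOf c → B ⊆ edgesOf c := by
    rintro c hc h e (rfl | ⟨he, h1, h2⟩)
    · exact h
    · refine (hT.mem_iff_of_leaves huniq hE he h2 (fun h3 => ?_)
        (ind_mem_circulations_of_isCircuit hc.1)).2 h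
      exact hT.not_reach_src (hT.2.2 _) e he rfl (h3.trans h1)
  have hsucc : D.SuccClosed B := by
    rintro e (rfl | ⟨he, h1, h2⟩)
    · obtain ⟨f, hf, h3, h4⟩ := exists_first_edge (hT.reach_of_notMem huniq hb)
        (D.loopless e).symm
      exact ⟨f, Or.inr ⟨hf, h3 ▸ .refl, h4⟩, h3.symm⟩
    · by_cases heq : D.tgt e = D.src b
      · exact ⟨b, Or.inl rfl, heq⟩
      · obtain ⟨f, hf, h3, h4⟩ := exists_first_edge h2 heq
        exact ⟨f, Or.inr ⟨hf, h3 ▸ h1.step he, h4⟩, h3.symm⟩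
  have hne : B.Nonempty := ⟨b, Or.inl rfl⟩
  refine hc.eq_of_edgesOf_eq hc' ?_
  rw [← hc.eq_of_succClosed hne (hsub hc h) hsucc, hc'.eq_of_succClosed hne (hsub hc' h') hsucc]

theorem pairwiseDisjoint_cycles [Fintype V] [Fintype E] (hT : D.IsArborescence u T)
    (huniq : ∀ T', D.IsArborescence u T' → T' = T)
    (hE : ind (Set.univ : Set E) ∈ D.circulations) : D.cycles.PairwiseDisjoint edgesOf := by
  intro c hc c' hc' hne
  refine Set.disjoint_left.2 fun e he he' => hne ?_
  by_cases heT : e ∈ T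
  · obtain ⟨b, h1, h2, -, -⟩ := hT.cut_eq huniq hE heT
    -- Tree edges never leave a set of descendants, so the case of an edge outside `T` applies to
    -- `b`.
    have hb : b ∉ T := fun hb => h2 (h1.step hb)
    exact hT.eq_of_mem_of_notMem huniq hE hb hc hc'
      ((hT.mem_iff_of_leaves huniq hE heT h1 h2 (ind_mem_circulations_of_isCircuit hc.1)).1 he)
      ((hT.mem_iff_of_leaves huniq hE heT h1 h2 (ind_mem_circulations_of_isCircuit hc'.1)).1 he')
  · exact hT.eq_of_mem_of_notMem huniq hE heT hc hc' he he'

end IsArborescence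

end MultiDigraph

/-! ### The cycle of implications. -/

theorem theorem2 {V E : Type*} [Fintype V] [Fintype E] [Nonempty E] (D : MultiDigraph V E)
    (hconn : D.IsConnected) (heul : D.IsEulerian) :
    List.TFAE [
      ∀ c ∈ D.cycles, ∀ c' ∈ D.cycles, c ≠ c' →
        Disjoint (MultiDigraph.edgesOf c) (MultiDigraph.edgesOf c'),
      ∀ e : E, ∃! c, c ∈ D.cycles ∧ e ∈ MultiDigraph.edgesOf c,
      D.IsCyclePartition D.cycles,
      ∃! P, D.IsCyclePartition P,
      D.MemS,
      (D.cycles.ncard : ℤ) = (Fintype.card E : ℤ) - (Fintype.card V : ℤ) + 1,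
      ∃ u : V, ∃! T, D.IsArborescence u T,
      ∀ u : V, ∃! T, D.IsArborescence u T,
      MultiDigraph.IsLatticeOrder D.EulerianPartition,
      MultiDigraph.IsLatticeOrder D.EulerianPartition ∧
        ∃! x : D.EulerianPartition, IsMin x] := by
  have hE := heul.ind_mem_circulations
  have hV : Nonempty V := hconn.nonempty
  have hpart : (∀ e : E, ∃! c, c ∈ D.cycles ∧ e ∈ MultiDigraph.edgesOf c) →
      D.IsCyclePartition D.cycles := fun h =>
    ⟨subset_rfl, fun c hc c' hc' hne => Set.disjoint_left.2 fun e he he' =>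
      hne ((h e).unique ⟨hc, he⟩ ⟨hc', he'⟩), Set.eq_univ_of_forall fun e => by
        obtain ⟨c, hc, -⟩ := h e
        exact Set.mem_biUnion hc.1 hc.2⟩
  tfae_have 1 → 2 := by
    intro h e
    obtain ⟨c, hc, he, -⟩ :=
      MultiDigraph.exists_isCycle_mem_of_ind_mem_circulations hE (Set.mem_univ e)
    exact ⟨c, ⟨hc, he⟩, fun c' hc' => by_contra fun hne =>
      Set.disjoint_left.1 (h c' hc'.1 c hc hne) hc'.2 he⟩
  tfae_have 2 → 3 := hpart
  tfae_have 3 → 1 := fun h c hc c' hc' hne => h.2.1 hc hc' hne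
  tfae_have 1 → 5 := fun h => MultiDigraph.memS_of_pairwiseDisjoint hconn hE
    fun c hc c' hc' hne => h c hc c' hc' hne
  tfae_have 5 → 6 := MultiDigraph.MemS.ncard_cycles
  tfae_have 6 → 4 := fun h => MultiDigraph.existsUnique_isCyclePartition_of_linearIndependent hE
    (MultiDigraph.linearIndependent_of_ncard_cycles hE h)
  tfae_have 4 → 1 := by
    intro h c hc c' hc' hne
    -- Each cycle lies in some partition; as these coincide, both cycles are members of one disjoint
    -- family.
    obtain ⟨P, hP, hcP⟩ := MultiDigraph.exists_isCyclePartition_mem hE hc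
    obtain ⟨P', hP', hcP'⟩ := MultiDigraph.exists_isCyclePartition_mem hE hc'
    exact hP.2.1 hcP (h.unique hP' hP ▸ hcP') hne
  tfae_have 5 → 8 := fun h => h.existsUnique_isArborescence hconn hE
  tfae_have 8 → 7 := fun h => ⟨hV.some, h _⟩
  tfae_have 7 → 1 := fun ⟨_, _, hT, huniq⟩ c hc c' hc' hne =>
    hT.pairwiseDisjoint_cycles huniq hE hc hc' hne
  tfae_have 3 → 10 := fun h => h.isLatticeOrder_and_existsUnique_isMin
  tfae_have 10 → 9 := fun h => h.1
  tfae_have 9 → 4 := MultiDigraph.existsUnique_isCyclePartition_of_isLatticeOrder hE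
  tfae_finish
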